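/- A graphon is a symmetric measurable function $g:[0,1]^2\to[0,1]$. Put $d_g(x)=\int_0^1 g(x,y)\,dy$, and let $t_1(g)=\int_0^1 d_g(x)\,dx$ and $t_2(g)=\int_0^1 d_g(x)^2\,dx$ be its edge density and its 2-star density. Let $$\mathcal S(g)=\tfrac12\int_{[0,1]^2}\bigl[-g\log g-(1-g)\log(1-g)\bigr]\,dx\,dy .$$ A \emph{maximizer at} $\tau=(\epsilon,\tau_2)$ is a graphon that maximizes $\mathcal S$ among all graphons with $(t_1,t_2)=\tau$. Let $\Omega\subset\mathbb R^2$ be the set of all pairs $(t_1(g),t_2(g))$, $g$ a graphon. Two graphons are \emph{equivalent} if they are related by the equivalence relation generated by replacing $g(x,y)$ by $g(\psi(x),\psi(y))$, with $\psi:[0,1]\to[0,1]$ measure preserving, and by changes on null sets. The cut distance is $\delta_\square(g,h)=\inf_\varphi\sup_{S,T}\bigl|\int_{S\times T}\bigl(g(x,y)-h(\varphi(x),\varphi(y))\bigr)\,dx\,dy\bigr|$, with $S,T\subset[0,1]$ measurable and $\varphi$ an invertible measure-preserving map of $[0,1]$. Let $g_c$ be the g-clique with edge density $1/2$ ($g_c(x,y)=1$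 if $x,y<2^{-1/2}$, and $0$ otherwise) and $g_a$ the g-anticlique with edge density $1/2$ ($g_a(x,y)=0$ if $x,y>1-2^{-1/2}$, and $1$ otherwise). (i) For every $\eta>0$ there is $\tau^*<2^{-3/2}$ such that, for every $\tau_2$ with $\tau^*<\tau_2\le 2^{-3/2}$, there are two inequivalent maximizers $g,h$ at $(1/2,\tau_2)$ with $\delta_\square(g,g_c)<\eta$ and $\delta_\square(h,g_a)<\eta$. In particular, for some $\tau^*<2^{-3/2}$, the maximizer is not unique up to equivalence at any point of the segment $\{(1/2,\tau_2):\tau^*<\tau_2\le 2^{-3/2}\}$. (ii) Near $(1/2,2^{-3/2})$ the maximizers do not vary continuously with the constraints: for every neighbourhood $U$ of $(1/2,2^{-3/2})$, every choice $\tau\mapsto g_\tau$ of a maximizer at each $\tau\in U\cap\operatorname{int}\Omega$ fails to be continuous on $U\cap\operatorname{int}\Omega$ with respect to $\delta_\square$. -/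

import Mathlib

open Set Filter Topology MeasureTheory

noncomputable section

/-- A graphon: a symmetric measurable function `[0,1]² → [0,1]`. -/
structure Graphon where
  toFun : unitInterval → unitInterval → ℝ
  symm' : ∀ x y, toFun x y = toFun y x
  mem' : ∀ x y, toFun x y ∈ Icc (0 : ℝ) 1
  measurable' : Measurable (Function.uncurry toFun)

namespace Graphon

instance : CoeFun Graphon (fun _ => unitInterval → unitInterval → ℝ) := ⟨Graphon.toFun⟩

/-- The degree function `d(x) = ∫₀¹ g(x,y) dy`. -/
def degree (g : Graphon) (x : unitInterval) : ℝ := ∫ y, g x y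

/-- The `k`-star density `t_k(g) = ∫₀¹ d(x)^k dx`; the edge density is the case `k = 1`. -/
def starDensity (k : ℕ) (g : Graphon) : ℝ := ∫ x, g.degree x ^ k

/-- The Shannon entropy density `½ ∬ S(g(x,y)) dx dy`,
where `S(w) = -w log w - (1-w) log (1-w)` with the natural logarithm. -/
def entropy (g : Graphon) : ℝ :=
  (1 / 2) * ∫ p : unitInterval × unitInterval, Real.binEntropy (g p.1 p.2)

/-- The pair (edge density, 2-star density). -/
def densities (g : Graphon) : ℝ × ℝ := (starDensity 1 g, starDensity 2 g)

/-- `g` maximizes the entropy among all graphons with edge and 2-star densities `τ`. -/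
def IsMaximizer (g : Graphon) (τ : ℝ × ℝ) : Prop :=
  g.densities = τ ∧ ∀ h : Graphon, h.densities = τ → h.entropy ≤ g.entropy

/-- The pairs of densities in the 2-star model that are attained by graphons. -/
def feasible : Set (ℝ × ℝ) := range densities

/-- The relabelled graphon `(x, y) ↦ g (ψ x) (ψ y)`. -/
def relabel (g : Graphon) (ψ : unitInterval → unitInterval) (hψ : Measurable ψ) : Graphon where
  toFun x y := g (ψ x) (ψ y)
  symm' _ _ := g.symm' _ _
  mem' _ _ := g.mem' _ _
  measurable' :=
    g.measurable'.comp ((hψ.comp measurable_fst).prodMk (hψ.comp measurable_snd))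

/-- `h` is, up to a null set, obtained from `g` by a measure-preserving relabelling. -/
def IsRelabelling (g h : Graphon) : Prop :=
  ∃ (ψ : unitInterval → unitInterval) (hψ : MeasurePreserving ψ volume volume),
    ∀ᵐ p : unitInterval × unitInterval, h p.1 p.2 = g.relabel ψ hψ.measurable p.1 p.2

/-- Equivalence of graphons: the equivalence relation generated by relabelling. -/
def Equivalent : Graphon → Graphon → Prop := Relation.EqvGen IsRelabelling

/-- The cut norm distance `sup |∫_{S×T} (g - h)|` over measurable `S, T ⊆ [0,1]`. -/
def cutNormDist (g h : Graphon) : ℝ :=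
  sSup {r | ∃ S T : Set unitInterval, MeasurableSet S ∧ MeasurableSet T ∧
    r = |∫ p in S ×ˢ T, (g p.1 p.2 - h p.1 p.2)|}

/-- The cut metric on reduced graphons: the infimum of the cut norm distance over
invertible measure-preserving relabellings. -/
def cutDist (g h : Graphon) : ℝ :=
  sInf {r | ∃ φ : unitInterval ≃ᵐ unitInterval, MeasurePreserving φ volume volume ∧
    r = cutNormDist g (h.relabel φ φ.measurable)}

/-- The g-clique: `1` if `x < c` and `y < c`, and `0` otherwise. -/
def clique (c : ℝ) : Graphon where
  toFun x y := if (x : ℝ) < c ∧ (y : ℝ) < c then 1 else 0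
  symm' x y := by simp only [and_comm]
  mem' x y := by split_ifs <;> simp
  measurable' := by
    refine Measurable.ite ?_ measurable_const measurable_const
    exact (measurableSet_lt (measurable_subtype_coe.comp measurable_fst) measurable_const).inter
      (measurableSet_lt (measurable_subtype_coe.comp measurable_snd) measurable_const)

/-- The g-anticlique: `0` if `x > c` and `y > c`, and `1` otherwise. -/
def anticlique (c : ℝ) : Graphon where
  toFun x y := if c < (x : ℝ) ∧ c < (y : ℝ) then 0 else 1
  symm' x y := by simp only [and_comm]
  mem' x y := by split_ifs <;> simp
  measurable' := by
    refine Measurable.ite ?_ measurable_const measurable_const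
    exact (measurableSet_lt measurable_const (measurable_subtype_coe.comp measurable_fst)).inter
      (measurableSet_lt measurable_const (measurable_subtype_coe.comp measurable_snd))

/-- A family of graphons `G τ` depends continuously on `τ ∈ A`, in the cut metric. -/
def CutContinuousOn (G : ℝ × ℝ → Graphon) (A : Set (ℝ × ℝ)) : Prop :=
  ∀ τ ∈ A, Tendsto (fun σ => cutDist (G σ) (G τ)) (𝓝[A] τ) (𝓝 0)

end Graphon

end

/-! Write c = 2^(-1/2), so that c^2 = 1/2 and c^3 = 2^(-3/2). Replacing g by 1 - g keeps the entropy
and, when t_1 = 1/2, both densities, so maximizers over the line t_1 = 1/2 come in pairs. The clique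
with edge density r^2 has 2-star density r^3, and near the corner (1/2, c^3) only graphons close to
a clique or to an anticlique have so many 2-stars. The theorem follows from a quantitative form of
this fact.

Suppose the degree function decreases and crosses the diagonal at a: degrees are at least a before a
and at most a after it. If a ≥ 1/2 and r = √t_1 is near c, counting 2-stars gives t_2 ≤ r^3 - (r -
a)^2/100 (`IsCore.two_star_le_clique`). If a < 1/2, the complement crosses at 1 - a. Near the corner
this forces a ≈ r for g or for its complement. Then that graphon is L¹-close to the clique
(`IsCore.integral_abs_sub_clique_le`), and its 3-star density is near c^4 = 1/4, whereas the
anticlique has about 0.31.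

Decreasing degrees cost nothing (`exists_antitone_rearrangement`): averaging g over the level sets
of its degree keeps the degrees and, by concavity, loses no entropy; then the vertices are
reordered. They also yield the existence of maximizers: weak limits alone need not preserve t_2, but
Helly's theorem makes the degrees converge almost everywhere.

For (i), take a maximizer and its complement; the 3-star density, an invariant, separates them. For
(ii), follow a short segment of slope 1 just below the corner. At its left end the clique bound
excludes clique-like graphons, at its right end anticlique-like ones are excluded. The 3-star
density is Lipschitz in the cut metric and would have to cross a gap in its possible values. -/

/-! ### Entropy against cross entropy -/

/-- One term of Gibbs' inequality. -/
lemma neg_mul_log_le {w k : ℝ} (hw : 0 ≤ w) (hk : 0 < k) :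
    w * Real.log w⁻¹ ≤ -(w * Real.log k) + (k - w) := by
  rcases hw.eq_or_lt with rfl | hw
  · simp [hk.le]
  · have h := Real.log_le_sub_one_of_pos (div_pos hk hw)
    rw [Real.log_div hk.ne' hw.ne'] at h
    have h2 := mul_le_mul_of_nonneg_left h hw.le
    have h3 : w * (k / w - 1) = k - w := by field_simp
    rw [Real.log_inv]
    nlinarith

/-- Gibbs' inequality for Bernoulli laws. -/
lemma binEntropy_le_crossEntropy {w k : ℝ} (hw : w ∈ Icc (0 : ℝ) 1) (hk : k ∈ Ioo (0 : ℝ) 1) :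
    Real.binEntropy w ≤ w * -Real.log k + (1 - w) * -Real.log (1 - k) := by
  have h1 := neg_mul_log_le hw.1 hk.1
  have h2 := neg_mul_log_le (sub_nonneg.2 hw.2) (sub_pos.2 hk.2)
  unfold Real.binEntropy
  linarith

/-- `k` moved towards `1/2`, so that its logarithm is bounded. -/
noncomputable def smoothed (ε k : ℝ) : ℝ := (1 - ε) * k + ε / 2

lemma smoothed_mem {ε k : ℝ} (hε : ε ∈ Ioo (0 : ℝ) 1) (hk : k ∈ Icc (0 : ℝ) 1) :
    smoothed ε k ∈ Icc (ε / 2) (1 - ε / 2) := by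
  obtain ⟨h1, h2⟩ := hε
  obtain ⟨h3, h4⟩ := hk
  unfold smoothed
  constructor <;> nlinarith

lemma mul_neg_log_le {k ε s : ℝ} (hk : 0 ≤ k) (hε : ε ∈ Ioo (0 : ℝ) 1)
    (hs : (1 - ε) * k ≤ s) : k * -Real.log s ≤ k * Real.log k⁻¹ + k * -Real.log (1 - ε) := by
  rcases hk.eq_or_lt with rfl | hk
  · simp
  · have h1 : 0 < 1 - ε := by linarith [hε.2]
    have h := Real.log_le_log (by positivity) hs
    rw [Real.log_mul h1.ne' hk.ne'] at h
    rw [Real.log_inv]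
    nlinarith

/-- Smoothing costs little: `smoothed ε k` is at least (1 - ε) k and its complement to 1 is at least
(1 - ε)(1 - k), so each logarithm changes by at most -log (1 - ε). -/
lemma crossEntropy_smoothed_le {ε k : ℝ} (hε : ε ∈ Ioo (0 : ℝ) 1) (hk : k ∈ Icc (0 : ℝ) 1) :
    k * -Real.log (smoothed ε k) + (1 - k) * -Real.log (1 - smoothed ε k)
      ≤ Real.binEntropy k - Real.log (1 - ε) := by
  have h1 := mul_neg_log_le (s := smoothed ε k) hk.1 hε (by unfold smoothed; linarith [hε.1])
  have h2 := mul_neg_log_le (s := 1 - smoothed ε k) (sub_nonneg.2 hk.2) hε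
    (by unfold smoothed; linarith [hε.1])
  unfold Real.binEntropy
  linarith

lemma abs_log_le_of_mem {ε s : ℝ} (hε : ε ∈ Ioo (0 : ℝ) 1) (hs : s ∈ Icc (ε / 2) (1 - ε / 2)) :
    |Real.log s| ≤ -Real.log (ε / 2) := by
  have h0 : 0 < ε / 2 := by linarith [hε.1]
  have h1 := Real.log_le_log h0 hs.1
  have h2 : Real.log s ≤ 0 := Real.log_nonpos (by linarith [hs.1]) (by linarith [hs.2, hε.1])
  rw [abs_of_nonpos h2]; linarith

/-! ### Weak compactness and semicontinuity of entropy -/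

section WeakLimits

variable {X Y : Type*} [MeasurableSpace X] [MeasurableSpace Y]

lemma integrable_of_measurable_of_bound {μ : Measure X} [IsFiniteMeasure μ] {f : X → ℝ}
    (hf : Measurable f) {C : ℝ} (h : ∀ x, |f x| ≤ C) : Integrable f μ :=
  Integrable.of_bound hf.aestronglyMeasurable C (ae_of_all _ h)

lemma integrable_of_mem_Icc {μ : Measure X} [IsFiniteMeasure μ] {f : X → ℝ}
    (hf : Measurable f) (h : ∀ x, f x ∈ Icc (0 : ℝ) 1) : Integrable f μ :=
  integrable_of_measurable_of_bound hf (C := 1)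
    fun x => abs_le.2 ⟨by linarith [(h x).1], (h x).2⟩

/-- Convergence of `g n`, transported along `T`, to `k` against bounded test functions. -/
def TendstoWeakly (l : Filter ℕ) (μ : Measure Y) (ν : Measure X) (T : Y → X)
    (g : ℕ → Y → ℝ) (k : X → ℝ) : Prop :=
  ∀ F : X → ℝ, Measurable F → ∀ C : ℝ, (∀ x, |F x| ≤ C) →
    Tendsto (fun n => ∫ y, g n y * F (T y) ∂μ) l (𝓝 (∫ x, k x * F x ∂ν))

lemma memLp_of_measurable_of_bound {μ : Measure X} [IsFiniteMeasure μ] {f : X → ℝ}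
    (hf : Measurable f) {C : ℝ} (h : ∀ x, |f x| ≤ C) : MemLp f 2 μ :=
  MemLp.of_bound hf.aestronglyMeasurable C (ae_of_all _ h)

/-- Composition with T embeds L²(ν) isometrically in L²(μ), so pairing with g n gives functionals of
norm at most 1 on L²(ν). Banach–Alaoglu provides a limit along the ultrafilter and Riesz represents
it by k. In effect k is the weak limit of the conditional expectations of g n given T. -/
lemma exists_tendstoWeakly_of_memLp {μ : Measure Y} {ν : Measure X} [IsProbabilityMeasure μ]
    [IsProbabilityMeasure ν] {T : Y → X} (hT : MeasurePreserving T μ ν) (l : Ultrafilter ℕ)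
    {g : ℕ → Y → ℝ} (hg : ∀ n, Measurable (g n)) (hg' : ∀ n y, g n y ∈ Icc (0 : ℝ) 1) :
    ∃ k : X → ℝ, MemLp k 2 ν ∧ TendstoWeakly l μ ν T g k := by
  have hb : ∀ n y, |g n y| ≤ 1 := fun n y =>
    abs_le.2 ⟨by linarith [(hg' n y).1], (hg' n y).2⟩
  let G : ℕ → Lp ℝ 2 μ := fun n => (memLp_of_measurable_of_bound (hg n) (hb n)).toLp (g n)
  have hG : ∀ n, ‖G n‖ ≤ 1 := by
    intro n
    refine (Lp.norm_le_of_ae_bound (C := 1) zero_le_one ?_).trans ?_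
    · filter_upwards [MemLp.coeFn_toLp (memLp_of_measurable_of_bound (hg n) (hb n))] with y hy
      rw [hy]; exact hb n y
    · simp [measureUnivNNReal]
  let Λ : ℕ → StrongDual ℝ (Lp ℝ 2 ν) := fun n =>
    (innerSL ℝ (G n)).comp (Lp.compMeasurePreservingₗᵢ ℝ T hT).toContinuousLinearMap
  have hΛ : ∀ n, ‖Λ n‖ ≤ 1 := by
    intro n
    refine ContinuousLinearMap.opNorm_le_bound _ zero_le_one fun F => ?_
    have h1 : ‖Λ n F‖ ≤ ‖G n‖ * ‖Lp.compMeasurePreservingₗᵢ ℝ T hT F‖ :=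
      norm_inner_le_norm (𝕜 := ℝ) (G n) (Lp.compMeasurePreservingₗᵢ ℝ T hT F)
    rw [LinearIsometry.norm_map] at h1
    exact h1.trans (mul_le_mul_of_nonneg_right (hG n) (norm_nonneg _))
  have hc := WeakDual.isCompact_closedBall (𝕜 := ℝ) (0 : StrongDual ℝ (Lp ℝ 2 ν)) 1
  obtain ⟨Φ, -, hΦ⟩ := hc.ultrafilter_le_nhds' (l.map fun n => StrongDual.toWeakDual (Λ n))
    (by
      refine Ultrafilter.mem_map.2 (Filter.univ_mem' fun n => ?_)
      simpa using hΛ n)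
  have hΦ' : Tendsto (fun n => StrongDual.toWeakDual (Λ n)) l (𝓝 Φ) := hΦ
  let k : Lp ℝ 2 ν := (InnerProductSpace.toDual ℝ (Lp ℝ 2 ν)).symm (WeakDual.toStrongDual Φ)
  refine ⟨k, Lp.memLp k, fun F hF C hC => ?_⟩
  have hFm : MemLp F 2 ν := memLp_of_measurable_of_bound hF hC
  have ht : Tendsto (fun n => Λ n (hFm.toLp F)) l (𝓝 (Φ (hFm.toLp F))) :=
    ((WeakDual.eval_continuous (hFm.toLp F)).tendsto Φ).comp hΦ'
  have e1 : ∀ n, Λ n (hFm.toLp F) = ∫ y, g n y * F (T y) ∂μ := by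
    intro n
    change inner ℝ (G n) (Lp.compMeasurePreserving T hT (hFm.toLp F)) = _
    rw [Lp.toLp_compMeasurePreserving hFm hT, L2.inner_def]
    refine integral_congr_ae ?_
    filter_upwards [MemLp.coeFn_toLp (memLp_of_measurable_of_bound (hg n) (hb n)),
      MemLp.coeFn_toLp (hFm.comp_measurePreserving hT)] with y h1 h2
    rw [h1, h2]
    simp [mul_comm]
  have e2 : Φ (hFm.toLp F) = ∫ x, k x * F x ∂ν := by
    have : Φ (hFm.toLp F) = inner ℝ k (hFm.toLp F) := by
      simp only [k]
      rw [InnerProductSpace.toDual_symm_apply]; rfl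
    rw [this, L2.inner_def]
    refine integral_congr_ae ?_
    filter_upwards [MemLp.coeFn_toLp hFm] with y h1
    rw [h1]
    simp [mul_comm]
  simpa only [e1, e2] using ht

lemma TendstoWeakly.congr_ae {l : Filter ℕ} {μ : Measure Y} {ν : Measure X} {T : Y → X}
    {g : ℕ → Y → ℝ} {k k' : X → ℝ} (h : TendstoWeakly l μ ν T g k) (hk : k =ᵐ[ν] k') :
    TendstoWeakly l μ ν T g k' := by
  intro F hF C hC
  have : ∫ x, k' x * F x ∂ν = ∫ x, k x * F x ∂ν :=
    integral_congr_ae (by filter_upwards [hk] with x hx; rw [hx])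
  rw [this]; exact h F hF C hC

/-- Weak compactness of `[0,1]`-valued functions, along an ultrafilter. -/
lemma exists_tendstoWeakly {μ : Measure Y} {ν : Measure X} [IsProbabilityMeasure μ]
    [IsProbabilityMeasure ν] {T : Y → X} (hT : MeasurePreserving T μ ν) (l : Ultrafilter ℕ)
    {g : ℕ → Y → ℝ} (hg : ∀ n, Measurable (g n)) (hg' : ∀ n y, g n y ∈ Icc (0 : ℝ) 1) :
    ∃ k : X → ℝ, Measurable k ∧ (∀ x, k x ∈ Icc (0 : ℝ) 1) ∧ TendstoWeakly l μ ν T g k := by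
  obtain ⟨k₀, hk₀, hw₀⟩ := exists_tendstoWeakly_of_memLp hT l hg hg'
  obtain ⟨k₁, hk₁, hk₁'⟩ := hk₀.1.aemeasurable
  have hw₁ := hw₀.congr_ae hk₁'
  have hi₁ : Integrable k₁ ν := (hk₀.integrable (by norm_num)).congr hk₁'
  have hset : ∀ A : Set X, MeasurableSet A → Tendsto (fun n => ∫ y in T ⁻¹' A, g n y ∂μ) l
      (𝓝 (∫ x in A, k₁ x ∂ν)) := by
    intro A hA
    have := hw₁ (A.indicator 1) (measurable_one.indicator hA) 1 (fun x => by
      by_cases hx : x ∈ A <;> simp [hx])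
    have e1 : ∀ n, ∫ y, g n y * A.indicator (1 : X → ℝ) (T y) ∂μ = ∫ y in T ⁻¹' A, g n y ∂μ := by
      intro n
      rw [← integral_indicator (hT.measurable hA)]
      refine integral_congr_ae (ae_of_all _ fun y => ?_)
      by_cases hy : T y ∈ A <;> simp [hy, indicator]
    have e2 : ∫ x, k₁ x * A.indicator (1 : X → ℝ) x ∂ν = ∫ x in A, k₁ x ∂ν := by
      rw [← integral_indicator hA]
      refine integral_congr_ae (ae_of_all _ fun y => ?_)
      by_cases hy : y ∈ A <;> simp [hy, indicator]
    simpa only [e1, e2] using this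
  have hgi : ∀ n, Integrable (g n) μ := fun n => integrable_of_mem_Icc (hg n) (hg' n)
  have h0 : 0 ≤ᵐ[ν] k₁ := by
    refine ae_nonneg_of_forall_setIntegral_nonneg hi₁ fun A hA _ => ?_
    exact ge_of_tendsto' (hset A hA) fun n => integral_nonneg fun y => (hg' n y).1
  have h1 : k₁ ≤ᵐ[ν] 1 := by
    refine ae_le_of_forall_setIntegral_le hi₁ (integrable_const (1 : ℝ)) fun A hA _ => ?_
    refine le_of_tendsto' (hset A hA) fun n => ?_
    calc ∫ y in T ⁻¹' A, g n y ∂μ ≤ ∫ y in T ⁻¹' A, (1 : ℝ) ∂μ :=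
          integral_mono (hgi n).integrableOn (integrable_const _) fun y => (hg' n y).2
      _ = ∫ x in A, (1 : ℝ) ∂ν := by
          simp [measureReal_def, hT.measure_preimage hA.nullMeasurableSet]
  -- Testing on indicators gave the bounds only almost everywhere; truncation makes them hold at
  -- every point.
  refine ⟨fun x => max 0 (min (k₁ x) 1), by fun_prop, fun x => ?_, hw₁.congr_ae ?_⟩
  · exact ⟨le_max_left _ _, max_le zero_le_one (min_le_right _ _)⟩
  · filter_upwards [h0, h1] with x hx0 hx1
    change 0 ≤ k₁ x at hx0
    change k₁ x ≤ 1 at hx1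
    rw [min_eq_left hx1, max_eq_right hx0]

/-- Upper semicontinuity of entropy under weak convergence. -/
lemma TendstoWeakly.le_integral_binEntropy {μ : Measure Y} {ν : Measure X}
    [IsProbabilityMeasure μ] [IsProbabilityMeasure ν] {T : Y → X} (hT : MeasurePreserving T μ ν)
    {l : Filter ℕ} [l.NeBot] {g : ℕ → Y → ℝ} (hg : ∀ n, Measurable (g n))
    (hg' : ∀ n y, g n y ∈ Icc (0 : ℝ) 1) {k : X → ℝ} (hk : Measurable k)
    (hk' : ∀ x, k x ∈ Icc (0 : ℝ) 1) (h : TendstoWeakly l μ ν T g k) {s : ℕ → ℝ} {r : ℝ}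
    (hs : Tendsto s l (𝓝 r)) (hr : ∀ n, s n ≤ ∫ y, Real.binEntropy (g n y) ∂μ) :
    r ≤ ∫ x, Real.binEntropy (k x) ∂ν := by
  have hbe : Integrable (fun x => Real.binEntropy (k x)) ν :=
    integrable_of_measurable_of_bound (Real.binEntropy_continuous.measurable.comp hk)
      (C := Real.log 2) fun x => by
        rw [abs_of_nonneg (Real.binEntropy_nonneg (hk' x).1 (hk' x).2)]
        exact Real.binEntropy_le_log_two
  -- Gibbs' inequality bounds the entropy of g n by its cross entropy against the smoothed k. That
  -- bound is affine in g n with bounded coefficients, so it passes to the weak limit; ε → 0 then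
  -- removes the smoothing.
  have key : ∀ ε ∈ Ioo (0 : ℝ) 1, r ≤ ∫ x, Real.binEntropy (k x) ∂ν - Real.log (1 - ε) := by
    intro ε hε
    have hsm : Measurable fun x => smoothed ε (k x) := by unfold smoothed; fun_prop
    have hmem : ∀ x, smoothed ε (k x) ∈ Icc (ε / 2) (1 - ε / 2) := fun x => smoothed_mem hε (hk' x)
    have hmem' : ∀ x, 1 - smoothed ε (k x) ∈ Icc (ε / 2) (1 - ε / 2) := fun x =>
      ⟨by linarith [(hmem x).2], by linarith [(hmem x).1]⟩
    set A : X → ℝ := fun x => -Real.log (smoothed ε (k x)) with hA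
    set B : X → ℝ := fun x => -Real.log (1 - smoothed ε (k x)) with hB
    have hAm : Measurable A := (Real.measurable_log.comp hsm).neg
    have hBm : Measurable B := (Real.measurable_log.comp (measurable_const.sub hsm)).neg
    set C := -Real.log (ε / 2) with hC
    have hAb : ∀ x, |A x| ≤ C := fun x => by
      rw [hA, abs_neg]; exact abs_log_le_of_mem hε (hmem x)
    have hBb : ∀ x, |B x| ≤ C := fun x => by
      rw [hB, abs_neg]; exact abs_log_le_of_mem hε (hmem' x)
    have hAi : Integrable A ν := integrable_of_measurable_of_bound hAm hAb
    have hBi : Integrable B ν := integrable_of_measurable_of_bound hBm hBb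
    have hABi : ∀ n, Integrable (fun y => g n y * (A (T y) - B (T y))) μ := fun n =>
      integrable_of_measurable_of_bound (C := 1 * (C + C))
        ((hg n).mul ((hAm.comp hT.measurable).sub (hBm.comp hT.measurable))) fun y => by
          rw [abs_mul]
          refine mul_le_mul (abs_le.2 ⟨by linarith [(hg' n y).1], (hg' n y).2⟩)
            ((abs_sub _ _).trans (add_le_add (hAb _) (hBb _))) (abs_nonneg _) zero_le_one
    have hkAB : Integrable (fun x => k x * (A x - B x)) ν :=
      integrable_of_measurable_of_bound (C := 1 * (C + C)) (hk.mul (hAm.sub hBm)) fun y => by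
          rw [abs_mul]
          refine mul_le_mul (abs_le.2 ⟨by linarith [(hk' y).1], (hk' y).2⟩)
            ((abs_sub _ _).trans (add_le_add (hAb _) (hBb _))) (abs_nonneg _) zero_le_one
    have hBT : Integrable (fun y => B (T y)) μ := hT.integrable_comp_of_integrable hBi
    have hBe : ∫ y, B (T y) ∂μ = ∫ x, B x ∂ν := by
      rw [← hT.map_eq, integral_map hT.measurable.aemeasurable hBm.aestronglyMeasurable]
    have hn : ∀ n, s n ≤ (∫ y, g n y * (A (T y) - B (T y)) ∂μ) + ∫ x, B x ∂ν := by
      intro n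
      refine (hr n).trans ?_
      rw [← hBe, ← integral_add (hABi n) hBT]
      refine integral_mono ?_ ((hABi n).add hBT) fun y => ?_
      · exact integrable_of_measurable_of_bound
          (Real.binEntropy_continuous.measurable.comp (hg n)) (C := Real.log 2) fun x => by
            rw [abs_of_nonneg (Real.binEntropy_nonneg (hg' n x).1 (hg' n x).2)]
            exact Real.binEntropy_le_log_two
      · have hlo : smoothed ε (k (T y)) ∈ Ioo (0 : ℝ) 1 :=
          ⟨by linarith [(hmem (T y)).1, hε.1], by linarith [(hmem (T y)).2, hε.1]⟩
        have := binEntropy_le_crossEntropy (hg' n y) hlo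
        simp only [hA, hB]
        linarith
    have hlim := (h (fun x => A x - B x) (hAm.sub hBm) (C + C)
      (fun x => (abs_sub _ _).trans (add_le_add (hAb _) (hBb _)))).add_const (∫ x, B x ∂ν)
    refine (le_of_tendsto_of_tendsto' hs hlim hn).trans ?_
    rw [← integral_add hkAB hBi]
    have hlast : ∫ x, Real.binEntropy (k x) ∂ν - Real.log (1 - ε)
        = ∫ x, (Real.binEntropy (k x) - Real.log (1 - ε)) ∂ν := by
      rw [integral_sub hbe (integrable_const _)]; simp
    rw [hlast]
    refine integral_mono (hkAB.add hBi) (hbe.sub (integrable_const _)) fun x => ?_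
    have := crossEntropy_smoothed_le hε (hk' x)
    simp only [hA, hB]
    linarith
  have hlim : Tendsto (fun ε : ℝ => ∫ x, Real.binEntropy (k x) ∂ν - Real.log (1 - ε)) (𝓝[>] 0)
      (𝓝 (∫ x, Real.binEntropy (k x) ∂ν - Real.log (1 - 0))) := by
    refine Tendsto.mono_left ?_ nhdsWithin_le_nhds
    refine ContinuousAt.tendsto ?_
    have : ContinuousAt (fun ε : ℝ => Real.log (1 - ε)) 0 :=
      ContinuousAt.log (by fun_prop) (by norm_num)
    exact continuousAt_const.sub this
  simp only [sub_zero, Real.log_one] at hlim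
  refine ge_of_tendsto hlim ?_
  filter_upwards [Ioo_mem_nhdsGT (zero_lt_one' ℝ)] with ε hε using key ε hε

end WeakLimits

/-! ### Weak limits of symmetric kernels and their degrees -/

section SymmetricKernels

variable {Z S : Type*} [MeasurableSpace Z] [MeasurableSpace S]

/-- The swapped kernel is a weak limit of the same symmetric sequence, hence so is the average,
which is symmetric at every point and not just almost everywhere. -/
lemma TendstoWeakly.symmetrize {η : Measure Z} {ν : Measure S} [IsProbabilityMeasure η]
    [IsProbabilityMeasure ν] {t : Z → S} {l : Filter ℕ} {g : ℕ → Z → Z → ℝ}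
    (hsymm : ∀ n x y, g n x y = g n y x) {k : S × S → ℝ} (hk : Measurable k)
    (hk' : ∀ p, k p ∈ Icc (0 : ℝ) 1)
    (h : TendstoWeakly l (η.prod η) (ν.prod ν) (Prod.map t t) (fun n p => g n p.1 p.2) k) :
    TendstoWeakly l (η.prod η) (ν.prod ν) (Prod.map t t) (fun n p => g n p.1 p.2)
      (fun p => (k p + k p.swap) / 2) := by
  intro F hF C hC
  have h1 := h F hF C hC
  have h2 := h (fun p => F p.swap) (hF.comp measurable_swap) C (fun p => hC _)
  have e1 : ∀ n, ∫ y, g n y.1 y.2 * F (Prod.map t t y).swap ∂(η.prod η)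
      = ∫ y, g n y.1 y.2 * F (Prod.map t t y) ∂(η.prod η) := by
    intro n
    rw [← integral_prod_swap]
    refine integral_congr_ae (ae_of_all _ fun p => ?_)
    simp only [Prod.fst_swap, Prod.snd_swap, hsymm n p.2 p.1]
    rfl
  have e2 : ∫ x, k x * F x.swap ∂(ν.prod ν) = ∫ x, k x.swap * F x ∂(ν.prod ν) := by
    rw [← integral_prod_swap]
    simp
  have hb : ∀ (f : S × S → ℝ), (∀ p, f p ∈ Icc (0 : ℝ) 1) → ∀ p, |f p * F p| ≤ 1 * C := by
    intro f hf p
    rw [abs_mul]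
    exact mul_le_mul (abs_le.2 ⟨by linarith [(hf p).1], (hf p).2⟩) (hC p) (abs_nonneg _) zero_le_one
  have hi1 : Integrable (fun p => k p * F p) (ν.prod ν) :=
    integrable_of_measurable_of_bound (hk.mul hF) (hb k hk')
  have hi2 : Integrable (fun p => k p.swap * F p) (ν.prod ν) :=
    integrable_of_measurable_of_bound ((hk.comp measurable_swap).mul hF)
      (hb (fun p => k p.swap) fun p => hk' _)
  simp only [e1, e2] at h2
  have h3 := (h1.add h2).div_const 2
  have e3 : ∫ x, (k x + k x.swap) / 2 * F x ∂(ν.prod ν)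
      = (∫ x, k x * F x ∂(ν.prod ν) + ∫ x, k x.swap * F x ∂(ν.prod ν)) / 2 := by
    rw [← integral_add hi1 hi2, ← integral_div]
    congr 1; ext p; ring
  rw [e3]
  refine h3.congr fun n => ?_
  ring

lemma exists_symm_tendstoWeakly {η : Measure Z} {ν : Measure S} [IsProbabilityMeasure η]
    [IsProbabilityMeasure ν] {t : Z → S} (ht : MeasurePreserving t η ν) (l : Ultrafilter ℕ)
    {g : ℕ → Z → Z → ℝ} (hg : ∀ n, Measurable (Function.uncurry (g n)))
    (hsymm : ∀ n x y, g n x y = g n y x) (hg' : ∀ n x y, g n x y ∈ Icc (0 : ℝ) 1) :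
    ∃ k : S → S → ℝ, Measurable (Function.uncurry k) ∧ (∀ x y, k x y = k y x) ∧
      (∀ x y, k x y ∈ Icc (0 : ℝ) 1) ∧
      TendstoWeakly l (η.prod η) (ν.prod ν) (Prod.map t t) (fun n p => g n p.1 p.2)
        (fun p => k p.1 p.2) := by
  obtain ⟨k, hk, hk', hw⟩ := exists_tendstoWeakly (ht.prod ht) l
    (g := fun n p => g n p.1 p.2) hg (fun n p => hg' n p.1 p.2)
  refine ⟨fun x y => (k (x, y) + k (y, x)) / 2, ?_, fun x y => by ring, fun x y => ?_,
    hw.symmetrize hsymm hk hk'⟩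
  · exact (hk.add (hk.comp measurable_swap)).div_const 2
  · have h1 := hk' (x, y)
    have h2 := hk' (y, x)
    constructor <;> linarith [h1.1, h1.2, h2.1, h2.2]

/-- Test functions that depend on the first coordinate only see the kernel through its degrees, so
the degree of the limit is determined by the limits of the integrated degrees. -/
lemma TendstoWeakly.degree_ae_eq {η : Measure Z} {ν : Measure S} [IsProbabilityMeasure η]
    [IsProbabilityMeasure ν] {t : Z → S} (ht : Measurable t) {l : Filter ℕ} [l.NeBot]
    {g : ℕ → Z → Z → ℝ} (hg : ∀ n, Measurable (Function.uncurry (g n)))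
    (hg' : ∀ n x y, g n x y ∈ Icc (0 : ℝ) 1) {k : S → S → ℝ}
    (hk : Measurable (Function.uncurry k)) (hk' : ∀ x y, k x y ∈ Icc (0 : ℝ) 1)
    (h : TendstoWeakly l (η.prod η) (ν.prod ν) (Prod.map t t) (fun n p => g n p.1 p.2)
      (fun p => k p.1 p.2)) {D : S → ℝ} (hD : Integrable D ν)
    (hlim : ∀ A, MeasurableSet A →
      Tendsto (fun n => ∫ z in t ⁻¹' A, ∫ z', g n z z' ∂η ∂η) l (𝓝 (∫ s in A, D s ∂ν))) :
    (fun s => ∫ s', k s s' ∂ν) =ᵐ[ν] D := by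
  have hki : Integrable (fun p : S × S => k p.1 p.2) (ν.prod ν) :=
    integrable_of_mem_Icc hk fun p => hk' p.1 p.2
  refine hki.integral_prod_left.ae_eq_of_forall_setIntegral_eq _ _ hD fun A hA _ => ?_
  refine tendsto_nhds_unique ?_ (hlim A hA)
  have h1 := h (fun p => A.indicator 1 p.1)
    ((measurable_one.indicator hA).comp measurable_fst) 1 (fun x => by
      by_cases hx : x.1 ∈ A <;> simp [hx])
  have e1 : ∀ n, ∫ y, g n y.1 y.2 * A.indicator (1 : S → ℝ) (Prod.map t t y).1 ∂(η.prod η)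
      = ∫ z in t ⁻¹' A, ∫ z', g n z z' ∂η ∂η := by
    intro n
    have : Integrable (fun y : Z × Z => g n y.1 y.2 * A.indicator (1 : S → ℝ) (Prod.map t t y).1)
        (η.prod η) := by
      refine integrable_of_mem_Icc ((hg n).mul ((measurable_one.indicator hA).comp
        (ht.comp measurable_fst))) fun y => ?_
      by_cases hx : t y.1 ∈ A <;> simp [hx, (hg' n y.1 y.2).1, (hg' n y.1 y.2).2]
    rw [integral_prod _ this, ← integral_indicator (ht hA)]
    refine integral_congr_ae (ae_of_all _ fun z => ?_)
    by_cases hx : t z ∈ A <;> simp [hx, indicator]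
  have e2 : ∫ x, k x.1 x.2 * A.indicator (1 : S → ℝ) x.1 ∂(ν.prod ν)
      = ∫ s in A, ∫ s', k s s' ∂ν ∂ν := by
    have : Integrable (fun y : S × S => k y.1 y.2 * A.indicator (1 : S → ℝ) y.1)
        (ν.prod ν) := by
      refine integrable_of_mem_Icc (hk.mul ((measurable_one.indicator hA).comp
        measurable_fst)) fun y => ?_
      by_cases hx : y.1 ∈ A <;> simp [hx, (hk' y.1 y.2).1, (hk' y.1 y.2).2]
    rw [integral_prod _ this, ← integral_indicator hA]
    refine integral_congr_ae (ae_of_all _ fun z => ?_)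
    by_cases hx : z ∈ A <;> simp [hx, indicator]
  simpa only [e1, e2] using h1

end SymmetricKernels

/-! ### Decreasing quantile functions -/

/-- The decreasing quantile function of a probability measure on `[0,1]`. -/
noncomputable def decreasingQuantile (ν : Measure ℝ) (x : unitInterval) : ℝ :=
  sInf {s | 0 ≤ s ∧ ν.real (Ioi s) ≤ x}

section Quantile

variable {ν : Measure ℝ}

lemma one_mem_quantileSet (h : ν (Icc 0 1)ᶜ = 0) (x : unitInterval) :
    (1 : ℝ) ∈ {s : ℝ | 0 ≤ s ∧ ν.real (Ioi s) ≤ x} := by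
  refine ⟨zero_le_one, ?_⟩
  have : ν (Ioi 1) = 0 := measure_mono_null (fun s (hs : 1 < s) => fun h => by
    linarith [h.2]) h
  simp [measureReal_def, this, x.2.1]

lemma decreasingQuantile_mem (h : ν (Icc 0 1)ᶜ = 0) (x : unitInterval) :
    decreasingQuantile ν x ∈ Icc (0 : ℝ) 1 :=
  ⟨le_csInf ⟨1, one_mem_quantileSet h x⟩ fun _ hs => hs.1,
    csInf_le ⟨0, fun _ hs => hs.1⟩ (one_mem_quantileSet h x)⟩

lemma decreasingQuantile_antitone (h : ν (Icc 0 1)ᶜ = 0) : Antitone (decreasingQuantile ν) :=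
  fun x _ hxy => csInf_le_csInf ⟨0, fun _ hs => hs.1⟩ ⟨1, one_mem_quantileSet h x⟩
    fun _ hs => ⟨hs.1, hs.2.trans hxy⟩

variable [IsProbabilityMeasure ν]

/-- The infimum is attained because the tail s ↦ ν(s, ∞) is right continuous. This Galois connection
turns preimages of lower half-lines into intervals of the right length. -/
lemma decreasingQuantile_le_iff (h : ν (Icc 0 1)ᶜ = 0) (x : unitInterval) {s : ℝ} (hs : 0 ≤ s) :
    decreasingQuantile ν x ≤ s ↔ ν.real (Ioi s) ≤ x := by
  constructor
  · intro hq
    have hgt : ∀ u, s < u → ν.real (Ioi u) ≤ x := by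
      intro u hu
      obtain ⟨v, hv, hvu⟩ := exists_lt_of_csInf_lt ⟨1, one_mem_quantileSet h x⟩ (hq.trans_lt hu)
      exact (measureReal_mono (Ioi_subset_Ioi hvu.le)).trans hv.2
    have hU : ⋃ n : ℕ, Ioi (s + 1 / ((n : ℝ) + 1)) = Ioi s := by
      ext u
      simp only [mem_iUnion, mem_Ioi]
      constructor
      · rintro ⟨n, hn⟩
        have : (0 : ℝ) < 1 / ((n : ℝ) + 1) := by positivity
        linarith
      · intro hu
        obtain ⟨n, hn⟩ := exists_nat_one_div_lt (sub_pos.2 hu)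
        exact ⟨n, by linarith⟩
    have hmono : Monotone fun n : ℕ => Ioi (s + 1 / ((n : ℝ) + 1)) := by
      intro m n hmn
      refine Ioi_subset_Ioi ?_
      have : (1 : ℝ) / ((n : ℝ) + 1) ≤ 1 / ((m : ℝ) + 1) :=
        one_div_le_one_div_of_le (by positivity) (by exact_mod_cast Nat.succ_le_succ hmn)
      linarith
    have ht := tendsto_measure_iUnion_atTop (μ := ν) hmono
    rw [hU] at ht
    have ht' := (ENNReal.tendsto_toReal (measure_ne_top ν _)).comp ht
    refine le_of_tendsto' ht' fun n => hgt _ ?_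
    have : (0 : ℝ) < 1 / ((n : ℝ) + 1) := by positivity
    linarith
  · exact fun hx => csInf_le ⟨0, fun _ hs => hs.1⟩ ⟨hs, hx⟩

lemma measurePreserving_decreasingQuantile (h : ν (Icc 0 1)ᶜ = 0) :
    MeasurePreserving (decreasingQuantile ν) volume ν := by
  have hm : Measurable (decreasingQuantile ν) := (decreasingQuantile_antitone h).measurable
  refine ⟨hm, ?_⟩
  have : IsProbabilityMeasure (Measure.map (decreasingQuantile ν) volume) :=
    Measure.isProbabilityMeasure_map hm.aemeasurable
  refine Measure.ext_of_Iic _ _ fun s => ?_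
  rw [Measure.map_apply hm measurableSet_Iic]
  rcases lt_or_ge s 0 with hs | hs
  · have h1 : ν (Iic s) = 0 := measure_mono_null (fun u (hu : u ≤ s) => fun h => by
      linarith [h.1]) h
    have h2 : decreasingQuantile ν ⁻¹' Iic s = ∅ := by
      ext x
      simp only [mem_preimage, mem_Iic, mem_empty_iff_false, iff_false, not_le]
      exact hs.trans_le (decreasingQuantile_mem h x).1
    rw [h1, h2]; simp
  · have hp : ν.real (Ioi s) ∈ unitInterval := ⟨measureReal_nonneg, measureReal_le_one⟩
    have h2 : decreasingQuantile ν ⁻¹' Iic s = Ici (⟨ν.real (Ioi s), hp⟩ : unitInterval) := by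
      ext x
      simp only [mem_preimage, mem_Iic, mem_Ici]
      rw [decreasingQuantile_le_iff h x hs]; rfl
    rw [h2, unitInterval.volume_Ici, ← compl_Ioi, prob_compl_eq_one_sub measurableSet_Ioi,
      ENNReal.ofReal_sub _ measureReal_nonneg]
    simp [measureReal_def]

end Quantile

/-! ### Rearrangement to decreasing degrees -/

namespace Graphon

lemma degree_measurable (g : Graphon) : Measurable g.degree :=
  (g.measurable'.stronglyMeasurable.integral_prod_right (ν := volume)).measurable

lemma section_measurable (g : Graphon) (x : unitInterval) : Measurable (g x) :=
  g.measurable'.comp (measurable_const.prodMk measurable_id)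

lemma section_integrable (g : Graphon) (x : unitInterval) : Integrable (g x) :=
  integrable_of_mem_Icc (g.section_measurable x) (g.mem' x)

lemma degree_mem (g : Graphon) (x : unitInterval) : g.degree x ∈ Icc (0 : ℝ) 1 := by
  refine ⟨integral_nonneg fun y => (g.mem' x y).1, ?_⟩
  calc g.degree x ≤ ∫ _ : unitInterval, (1 : ℝ) :=
        integral_mono (g.section_integrable x) (integrable_const _) fun y => (g.mem' x y).2
    _ = 1 := by simp

/-- Every graphon can be replaced by one with decreasing degree function, the same star
densities and no less entropy. -/
lemma exists_antitone_rearrangement (g : Graphon) :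
    ∃ (g' : Graphon) (q : unitInterval → ℝ), Antitone q ∧ (∀ x, q x ∈ Icc (0 : ℝ) 1) ∧
      g'.degree =ᵐ[volume] q ∧ (∀ k, g'.starDensity k = g.starDensity k) ∧
      g.entropy ≤ g'.entropy := by
  set ν : Measure ℝ := Measure.map g.degree volume with hν
  have hdm := g.degree_measurable
  have : IsProbabilityMeasure ν := Measure.isProbabilityMeasure_map hdm.aemeasurable
  have ht : MeasurePreserving g.degree volume ν := ⟨hdm, rfl⟩
  have hsupp : ν (Icc 0 1)ᶜ = 0 := by
    rw [hν, Measure.map_apply hdm measurableSet_Icc.compl]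
    have : g.degree ⁻¹' (Icc 0 1)ᶜ = ∅ := by
      ext x; simpa using g.degree_mem x
    rw [this]; simp
  -- For a constant sequence the weak limit along the degree map is the average of g over pairs of
  -- degree levels, and semicontinuity of entropy becomes Jensen's inequality.
  obtain ⟨k, hk, hks, hk', hw⟩ := exists_symm_tendstoWeakly ht (hyperfilter ℕ)
    (g := fun _ => g) (fun _ => g.measurable') (fun _ => g.symm') (fun _ => g.mem')
  have hmem : ∀ᵐ s ∂ν, s ∈ Icc (0 : ℝ) 1 := by
    rw [ae_iff]; exact hsupp
  have hid : Integrable (fun s : ℝ => s) ν := by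
    refine Integrable.of_bound measurable_id.aestronglyMeasurable 1 ?_
    filter_upwards [hmem] with s hs
    rw [Real.norm_eq_abs]
    exact abs_le.2 ⟨by linarith [hs.1], hs.2⟩
  have hdeg := hw.degree_ae_eq hdm (fun _ => g.measurable') (fun _ => g.mem') hk hk' hid (by
    intro A hA
    have : ∫ s in A, s ∂ν = ∫ z in g.degree ⁻¹' A, g.degree z := by
      rw [hν, setIntegral_map hA (f := fun s => s) measurable_id.aestronglyMeasurable
        hdm.aemeasurable]
    rw [this]
    exact tendsto_const_nhds)
  set q := decreasingQuantile ν with hq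
  have hqp := measurePreserving_decreasingQuantile hsupp
  -- The averaged kernel lives on degree values, where a vertex s has degree s. Pulling it back
  -- along the quantile function gives degree q(x) at almost every x.
  let g' : Graphon :=
    { toFun := fun x y => k (q x) (q y)
      symm' := fun x y => hks _ _
      mem' := fun x y => hk' _ _
      measurable' := hk.comp ((hqp.measurable.comp measurable_fst).prodMk
        (hqp.measurable.comp measurable_snd)) }
  have hdeg' : g'.degree =ᵐ[volume] q := by
    have h1 : ∀ x, g'.degree x = ∫ s', k (q x) s' ∂ν := by
      intro x
      rw [← hqp.map_eq, integral_map hqp.measurable.aemeasurable]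
      · rfl
      · exact (hk.comp (measurable_const.prodMk measurable_id)).aestronglyMeasurable
    filter_upwards [hqp.quasiMeasurePreserving.ae hdeg] with x hx
    rw [h1, hx]
  refine ⟨g', q, decreasingQuantile_antitone hsupp, decreasingQuantile_mem hsupp, hdeg', ?_, ?_⟩
  · intro j
    have h1 : ∫ s, s ^ j ∂ν = g.starDensity j := by
      rw [hν, integral_map hdm.aemeasurable (by fun_prop)]; rfl
    rw [← h1, ← hqp.map_eq, integral_map hqp.measurable.aemeasurable (by fun_prop)]
    refine integral_congr_ae ?_
    filter_upwards [hdeg'] with x hx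
    rw [hx]
  · have h1 := hw.le_integral_binEntropy (ht.prod ht) (fun _ => g.measurable')
      (fun _ p => g.mem' p.1 p.2) hk (fun p => hk' p.1 p.2)
      (s := fun _ => ∫ p : unitInterval × unitInterval, Real.binEntropy (g p.1 p.2))
      tendsto_const_nhds (fun _ => le_rfl)
    have h2 : ∫ p, Real.binEntropy (k p.1 p.2) ∂(ν.prod ν)
        = ∫ p : unitInterval × unitInterval, Real.binEntropy (g' p.1 p.2) := by
      have hqq := hqp.prod hqp
      rw [← hqq.map_eq, integral_map (f := fun p : ℝ × ℝ => Real.binEntropy (k p.1 p.2))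
        hqq.measurable.aemeasurable
        (Real.binEntropy_continuous.measurable.comp hk).aestronglyMeasurable]
      rfl
    replace h1 := h1.trans_eq h2
    unfold entropy
    linarith

end Graphon

/-! ### Helly selection and existence of maximizers -/

/-- Helly's selection theorem for decreasing functions on the unit interval. -/
lemma exists_subseq_tendsto_of_antitone {q : ℕ → unitInterval → ℝ} (hq : ∀ n, Antitone (q n))
    (hq' : ∀ n x, q n x ∈ Icc (0 : ℝ) 1) :
    ∃ (Q : unitInterval → ℝ) (φ : ℕ → ℕ), Antitone Q ∧ (∀ x, Q x ∈ Icc (0 : ℝ) 1) ∧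
      StrictMono φ ∧ ∀ᵐ x, Tendsto (fun n => q (φ n) x) atTop (𝓝 (Q x)) := by
  set D := TopologicalSpace.denseSeq unitInterval with hD
  have hdense : Dense (range D) := TopologicalSpace.denseRange_denseSeq _
  obtain ⟨a, φ, hφ, ha⟩ := CompactSpace.tendsto_subseq
    (fun n => (fun i => ⟨q n (D i), hq' n (D i)⟩ : ℕ → Icc (0 : ℝ) 1))
  have ha' : ∀ i, Tendsto (fun n => q (φ n) (D i)) atTop (𝓝 (a i : ℝ)) := fun i =>
    (continuous_subtype_val.tendsto _).comp ((tendsto_pi_nhds.1 ha) i)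
  -- The subsequence is chosen to converge on a dense sequence only. Ultrafilter limits define Q
  -- everywhere, keep it decreasing and agree with the limits at the dense points.
  have hlim : ∀ x, ∃ L ∈ Icc (0 : ℝ) 1,
      Tendsto (fun n => q (φ n) x) (hyperfilter ℕ : Filter ℕ) (𝓝 L) := fun x =>
    isCompact_Icc.ultrafilter_le_nhds' ((hyperfilter ℕ).map fun n => q (φ n) x)
      (Ultrafilter.mem_map.2 (Filter.univ_mem' fun n => hq' _ x))
  choose Q hQ hQ' using hlim
  have hQD : ∀ i, Q (D i) = a i := fun i =>
    tendsto_nhds_unique (hQ' _) ((ha' i).mono_left Nat.hyperfilter_le_atTop)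
  have hanti : Antitone Q := fun x y hxy =>
    le_of_tendsto_of_tendsto' (hQ' y) (hQ' x) fun n => hq _ hxy
  refine ⟨Q, φ, hanti, hQ, hφ, ?_⟩
  -- At an interior continuity point, Q at nearby dense points on either side squeezes the sequence.
  -- A decreasing Q has countably many discontinuities, and 0 and 1 lack a neighbour on one side.
  have hnull : ∀ᵐ x : unitInterval, x ∉ {x | ¬ ContinuousAt Q x} ∪ {0, 1} := by
    refine measure_eq_zero_iff_ae_notMem.1 (Set.Countable.measure_zero ?_ _)
    exact hanti.countable_not_continuousAt.union (by simp)
  filter_upwards [hnull] with x hx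
  simp only [mem_union, mem_ofPred_eq, mem_insert_iff, mem_singleton_iff, not_or, not_not] at hx
  obtain ⟨hc, h0, h1⟩ := hx
  have h0' : 0 < x := lt_of_le_of_ne x.2.1 (Ne.symm h0)
  have h1' : x < 1 := lt_of_le_of_ne x.2.2 h1
  refine tendsto_order.2 ⟨fun b hb => ?_, fun b hb => ?_⟩
  · obtain ⟨u, hu, hsub⟩ := exists_Ico_subset_of_mem_nhds (hc.preimage_mem_nhds (Ioi_mem_nhds hb))
      ⟨1, h1'⟩
    obtain ⟨d, ⟨i, rfl⟩, hd⟩ := hdense.exists_between hu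
    have hbi : b < (a i : ℝ) := by rw [← hQD]; exact hsub ⟨hd.1.le, hd.2⟩
    filter_upwards [(ha' i).eventually_const_lt hbi] with n hn
    exact hn.trans_le (hq _ hd.1.le)
  · obtain ⟨u, hu, hsub⟩ := exists_Ioc_subset_of_mem_nhds (hc.preimage_mem_nhds (Iio_mem_nhds hb))
      ⟨0, h0'⟩
    obtain ⟨d, ⟨i, rfl⟩, hd⟩ := hdense.exists_between hu
    have hbi : (a i : ℝ) < b := by rw [← hQD]; exact hsub ⟨hd.1, hd.2.le⟩
    filter_upwards [(ha' i).eventually_lt_const hbi] with n hn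
    exact (hq _ hd.2.le).trans_lt hn

namespace Graphon

/-- The degree function of `g` is almost everywhere equal to the decreasing function `q`. -/
structure HasAntitoneDegree (g : Graphon) (q : unitInterval → ℝ) : Prop where
  antitone : Antitone q
  mem : ∀ x, q x ∈ Icc (0 : ℝ) 1
  ae_eq : g.degree =ᵐ[volume] q

lemma tendsto_setIntegral_pow {f : ℕ → unitInterval → ℝ} {Q : unitInterval → ℝ}
    (hf : ∀ n, Measurable (f n)) (hf' : ∀ n x, f n x ∈ Icc (0 : ℝ) 1)
    (h : ∀ᵐ x, Tendsto (fun n => f n x) atTop (𝓝 (Q x))) (k : ℕ) (A : Set unitInterval) :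
    Tendsto (fun n => ∫ x in A, f n x ^ k) atTop (𝓝 (∫ x in A, Q x ^ k)) := by
  refine tendsto_integral_of_dominated_convergence (fun _ => 1)
    (fun n => ((hf n).pow_const k).aestronglyMeasurable) (integrable_const _) (fun n => ?_) ?_
  · refine ae_of_all _ fun x => ?_
    rw [Real.norm_eq_abs, abs_pow, abs_of_nonneg (hf' n x).1]
    exact pow_le_one₀ (hf' n x).1 (hf' n x).2
  · filter_upwards [ae_restrict_of_ae h] with x hx using hx.pow k

/-- Compactness of the graphons with decreasing degrees, with semicontinuity of entropy. -/
lemma exists_limit_of_hasAntitoneDegree {g : ℕ → Graphon} {q : ℕ → unitInterval → ℝ}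
    (h : ∀ n, (g n).HasAntitoneDegree (q n)) {s : ℕ → ℝ} {r : ℝ} (hs : Tendsto s atTop (𝓝 r))
    (hsr : ∀ n, s n ≤ (g n).entropy) :
    ∃ (G : Graphon) (Q : unitInterval → ℝ) (φ : ℕ → ℕ), G.HasAntitoneDegree Q ∧ StrictMono φ ∧
      (∀ k, Tendsto (fun n => (g (φ n)).starDensity k) atTop (𝓝 (G.starDensity k))) ∧
      r ≤ G.entropy := by
  obtain ⟨Q, φ, hQ, hQ', hφ, hlim⟩ := exists_subseq_tendsto_of_antitone (fun n => (h n).antitone)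
    (fun n => (h n).mem)
  obtain ⟨k, hk, hks, hk', hw⟩ := exists_symm_tendstoWeakly (MeasurePreserving.id volume)
    (hyperfilter ℕ) (g := fun n => g (φ n)) (fun n => (g (φ n)).measurable')
    (fun n => (g (φ n)).symm') (fun n => (g (φ n)).mem')
  let G : Graphon := ⟨k, hks, hk', hk⟩
  -- Weak convergence of the kernels would not control powers of the degrees; convergence of the
  -- degrees almost everywhere does.
  have hdlim : ∀ᵐ x, Tendsto (fun n => (g (φ n)).degree x) atTop (𝓝 (Q x)) := by
    filter_upwards [hlim, ae_all_iff.2 fun n => (h n).ae_eq] with x hx hx'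
    simpa only [hx'] using hx
  have hpow := tendsto_setIntegral_pow (fun n => (g (φ n)).degree_measurable)
    (fun n => (g (φ n)).degree_mem) hdlim
  have hdeg : G.degree =ᵐ[volume] Q :=
    hw.degree_ae_eq measurable_id (fun n => (g (φ n)).measurable') (fun n => (g (φ n)).mem') hk hk'
      (integrable_of_mem_Icc hQ.measurable hQ')
      (fun A _ => by
        have := (hpow 1 A).mono_left Nat.hyperfilter_le_atTop
        simp only [pow_one] at this
        exact this)
  refine ⟨G, Q, φ, ⟨hQ, hQ', hdeg⟩, hφ, fun j => ?_, ?_⟩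
  · have h1 : G.starDensity j = ∫ x, Q x ^ j := by
      refine integral_congr_ae ?_
      filter_upwards [hdeg] with x hx
      rw [hx]
    have h2 := hpow j univ
    simp only [Measure.restrict_univ] at h2
    rw [h1]
    exact h2
  · have h1 := hw.le_integral_binEntropy
      ((MeasurePreserving.id volume).prod (MeasurePreserving.id volume))
      (fun n => (g (φ n)).measurable') (fun n p => (g (φ n)).mem' p.1 p.2) hk (fun p => hk' p.1 p.2)
      (s := fun n => 2 * s (φ n))
      (((hs.comp hφ.tendsto_atTop).const_mul 2).mono_left Nat.hyperfilter_le_atTop)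
      (fun n => by
        have := hsr (φ n)
        rw [← Measure.volume_eq_prod]
        change _ ≤ 1 / 2 * ∫ p, Real.binEntropy (Function.uncurry (g (φ n)).toFun p) at this
        linarith)
    have h2 : G.entropy = 1 / 2 * ∫ x, Real.binEntropy (Function.uncurry k x)
        ∂((volume : Measure unitInterval).prod volume) := rfl
    have h3 : 2 * r ≤ ∫ x, Real.binEntropy (Function.uncurry k x)
        ∂((volume : Measure unitInterval).prod volume) := h1
    rw [h2]; linarith

lemma entropy_le (g : Graphon) : g.entropy ≤ 1 / 2 * Real.log 2 := by
  refine mul_le_mul_of_nonneg_left ?_ (by norm_num)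
  calc ∫ p : unitInterval × unitInterval, Real.binEntropy (g p.1 p.2)
      ≤ ∫ _ : unitInterval × unitInterval, Real.log 2 := by
        refine integral_mono_of_nonneg (ae_of_all _ fun p => ?_) (integrable_const _)
          (ae_of_all _ fun p => Real.binEntropy_le_log_two)
        exact Real.binEntropy_nonneg (g.mem' _ _).1 (g.mem' _ _).2
    _ = Real.log 2 := by simp

/-- Every feasible pair of densities has a maximizer with decreasing degrees. -/
lemma exists_isMaximizer_hasAntitoneDegree {τ : ℝ × ℝ} (hτ : τ ∈ feasible) :
    ∃ (g : Graphon) (q : unitInterval → ℝ), g.HasAntitoneDegree q ∧ g.IsMaximizer τ := by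
  obtain ⟨g₀, hg₀⟩ := hτ
  set E := sSup {r | ∃ h : Graphon, h.densities = τ ∧ r = h.entropy} with hE
  have hne : {r | ∃ h : Graphon, h.densities = τ ∧ r = h.entropy}.Nonempty := ⟨_, g₀, hg₀, rfl⟩
  have hbdd : BddAbove {r | ∃ h : Graphon, h.densities = τ ∧ r = h.entropy} :=
    ⟨1 / 2 * Real.log 2, by rintro _ ⟨h, -, rfl⟩; exact h.entropy_le⟩
  have hex : ∀ n : ℕ, ∃ (g : Graphon) (q : unitInterval → ℝ), g.HasAntitoneDegree q ∧
      g.densities = τ ∧ E - 1 / ((n : ℝ) + 1) ≤ g.entropy := by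
    intro n
    have hlt : E - 1 / ((n : ℝ) + 1) < E := by
      have : (0 : ℝ) < 1 / ((n : ℝ) + 1) := by positivity
      linarith
    obtain ⟨_, ⟨h, hh, rfl⟩, hr⟩ := exists_lt_of_lt_csSup hne hlt
    obtain ⟨g, q, h1, h2, h3, h4, h5⟩ := h.exists_antitone_rearrangement
    refine ⟨g, q, ⟨h1, h2, h3⟩, ?_, hr.le.trans h5⟩
    rw [← hh]; simp [densities, h4]
  choose g q hgq hgd hge using hex
  have hs : Tendsto (fun n : ℕ => E - 1 / ((n : ℝ) + 1)) atTop (𝓝 E) := by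
    simpa using (tendsto_const_nhds (x := E)).sub (tendsto_one_div_add_atTop_nhds_zero_nat (𝕜 := ℝ))
  obtain ⟨G, Q, φ, hGQ, -, hden, hent⟩ := exists_limit_of_hasAntitoneDegree hgq hs hge
  refine ⟨G, Q, hGQ, ?_, fun h hh => (le_csSup hbdd ⟨h, hh, rfl⟩).trans hent⟩
  have hk : ∀ n, (g (φ n)).starDensity 1 = τ.1 ∧ (g (φ n)).starDensity 2 = τ.2 := fun n => by
    have := hgd (φ n)
    exact ⟨congrArg Prod.fst this, congrArg Prod.snd this⟩
  refine Prod.ext ?_ ?_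
  · have := hden 1
    simp only [(hk _).1] at this
    exact tendsto_nhds_unique this tendsto_const_nhds
  · have := hden 2
    simp only [(hk _).2] at this
    exact tendsto_nhds_unique this tendsto_const_nhds

end Graphon

/-! ### Two-star bounds from a core -/

namespace Graphon

/-- The part of the degree of `x` that goes into `A`. -/
noncomputable def partialDegree (g : Graphon) (A : Set unitInterval) (x : unitInterval) : ℝ :=
  ∫ y in A, g x y

/-- A set of measure `a` that contains the vertices of degree above `a` and none of the
vertices of degree below `a`. -/
structure IsCore (g : Graphon) (P : Set unitInterval) : Prop where
  measurableSet : MeasurableSet P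
  le_degree : ∀ᵐ x, x ∈ P → volume.real P ≤ g.degree x
  degree_le : ∀ᵐ x, x ∈ Pᶜ → g.degree x ≤ volume.real P

variable {g : Graphon} {P : Set unitInterval}

lemma partialDegree_measurable (g : Graphon) (A : Set unitInterval) :
    Measurable (g.partialDegree A) :=
  (g.measurable'.stronglyMeasurable.integral_prod_right (ν := volume.restrict A)).measurable

lemma partialDegree_add_compl (g : Graphon) {A : Set unitInterval} (hA : MeasurableSet A)
    (x : unitInterval) : g.partialDegree A x + g.partialDegree Aᶜ x = g.degree x :=
  integral_add_compl hA (g.section_integrable x)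

lemma partialDegree_nonneg (g : Graphon) (A : Set unitInterval) (x : unitInterval) :
    0 ≤ g.partialDegree A x := integral_nonneg fun y => (g.mem' x y).1

lemma partialDegree_le_measureReal (g : Graphon) (A : Set unitInterval) (x : unitInterval) :
    g.partialDegree A x ≤ volume.real A := by
  calc g.partialDegree A x ≤ ∫ _ in A, (1 : ℝ) :=
        integral_mono (g.section_integrable x).integrableOn (integrable_const _)
          fun y => (g.mem' x y).2
    _ = volume.real A := by simp

lemma partialDegree_le_degree (g : Graphon) (A : Set unitInterval) (x : unitInterval) :
    g.partialDegree A x ≤ g.degree x :=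
  setIntegral_le_integral (g.section_integrable x) (ae_of_all _ fun y => (g.mem' x y).1)

lemma partialDegree_mem (g : Graphon) (A : Set unitInterval) (x : unitInterval) :
    g.partialDegree A x ∈ Icc (0 : ℝ) 1 :=
  ⟨g.partialDegree_nonneg A x, (g.partialDegree_le_degree A x).trans (g.degree_mem x).2⟩

lemma integrable_degree_pow (g : Graphon) (k : ℕ) {μ : Measure unitInterval} [IsFiniteMeasure μ] :
    Integrable (fun x => g.degree x ^ k) μ :=
  integrable_of_mem_Icc (g.degree_measurable.pow_const k) fun x =>
    ⟨pow_nonneg (g.degree_mem x).1 k, pow_le_one₀ (g.degree_mem x).1 (g.degree_mem x).2⟩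

lemma integrable_degree (g : Graphon) {μ : Measure unitInterval} [IsFiniteMeasure μ] :
    Integrable g.degree μ := integrable_of_mem_Icc g.degree_measurable g.degree_mem

lemma integrable_partialDegree (g : Graphon) (A : Set unitInterval) {μ : Measure unitInterval}
    [IsFiniteMeasure μ] : Integrable (g.partialDegree A) μ :=
  integrable_of_mem_Icc (g.partialDegree_measurable A) (g.partialDegree_mem A)

lemma integrable_partialDegree_sq (g : Graphon) (A : Set unitInterval) {μ : Measure unitInterval}
    [IsFiniteMeasure μ] : Integrable (fun x => g.partialDegree A x ^ 2) μ :=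
  integrable_of_mem_Icc ((g.partialDegree_measurable A).pow_const 2) fun x =>
    ⟨sq_nonneg _, pow_le_one₀ (g.partialDegree_mem A x).1 (g.partialDegree_mem A x).2⟩

lemma starDensity_one_eq_add (g : Graphon) {A : Set unitInterval} (hA : MeasurableSet A) :
    g.starDensity 1 = (∫ x in A, g.degree x) + ∫ x in Aᶜ, g.degree x := by
  simp only [starDensity, pow_one]
  exact (integral_add_compl hA g.integrable_degree).symm

lemma starDensity_eq_add (g : Graphon) (k : ℕ) {A : Set unitInterval} (hA : MeasurableSet A) :
    g.starDensity k = (∫ x in A, g.degree x ^ k) + ∫ x in Aᶜ, g.degree x ^ k :=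
  (integral_add_compl hA (g.integrable_degree_pow k)).symm

lemma integral_partialDegree_comm (g : Graphon) (A B : Set unitInterval) :
    ∫ x in A, g.partialDegree B x = ∫ x in B, g.partialDegree A x := by
  unfold partialDegree
  rw [integral_integral_swap]
  · simp only [g.symm']
  · exact integrable_of_mem_Icc g.measurable' fun p => g.mem' p.1 p.2

/-- The right side equals (f + f')/2 - (f - f')²/(2a), which is at least min f f' because |f - f'| ≤
a. Unlike the minimum, it splits into products of one-variable functions, so it can be integrated
over pairs. -/
lemma kernel_le {m f f' a : ℝ} (ha : 0 < a) (hm : m ≤ f) (hm' : m ≤ f') (hf0 : 0 ≤ f)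
    (hf0' : 0 ≤ f') (hf : f ≤ a) (hf' : f' ≤ a) :
    m ≤ a⁻¹ * (f * f') + 1 / 2 * (f - a⁻¹ * f ^ 2) + 1 / 2 * (f' - a⁻¹ * f' ^ 2) := by
  have e : a⁻¹ * (f * f') + 1 / 2 * (f - a⁻¹ * f ^ 2) + 1 / 2 * (f' - a⁻¹ * f' ^ 2)
      = a⁻¹ * ((a * (f + f') - (f - f') ^ 2) / 2) := by field_simp; ring
  rw [e, inv_mul_eq_div, le_div_iff₀ ha]
  rcases le_total f f' with h | h <;> nlinarith

/-- The second moment of the degrees from the core into its complement. -/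
lemma IsCore.integral_sq_partialDegree_le (h : g.IsCore P) (ha : 0 < volume.real P) :
    ∫ y in P, g.partialDegree Pᶜ y ^ 2 ≤
      (volume.real P)⁻¹ * (∫ x in Pᶜ, g.degree x) ^ 2 + (1 - volume.real P) *
        ((∫ x in Pᶜ, g.degree x) - (volume.real P)⁻¹ * ∫ x in Pᶜ, g.degree x ^ 2) := by
  set a := volume.real P with hadef
  set ρ : Measure unitInterval := volume.restrict Pᶜ with hρ
  have hρu : ρ.real univ = 1 - a := by
    rw [hρ, measureReal_restrict_apply_univ, probReal_compl_eq_one_sub h.measurableSet]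
  have e1 : ∀ y, g.partialDegree Pᶜ y ^ 2 = ∫ z, g y z.1 * g y z.2 ∂(ρ.prod ρ) := by
    intro y
    rw [integral_prod_mul (μ := ρ) (ν := ρ) (g y) (g y), sq]; rfl
  have hm3 : Measurable fun q : unitInterval × unitInterval × unitInterval =>
      g q.1 q.2.1 * g q.1 q.2.2 :=
    (g.measurable'.comp (measurable_fst.prodMk (measurable_fst.comp measurable_snd))).mul
      (g.measurable'.comp (measurable_fst.prodMk (measurable_snd.comp measurable_snd)))
  have hm3' : ∀ q : unitInterval × unitInterval × unitInterval,
      g q.1 q.2.1 * g q.1 q.2.2 ∈ Icc (0 : ℝ) 1 := fun q =>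
    ⟨mul_nonneg (g.mem' _ _).1 (g.mem' _ _).1,
      mul_le_one₀ (g.mem' _ _).2 (g.mem' _ _).1 (g.mem' _ _).2⟩
  -- Expanding the square and swapping integrals counts common neighbours in P of pairs outside P.
  have e2 : ∫ y in P, g.partialDegree Pᶜ y ^ 2
      = ∫ z, (∫ y in P, g y z.1 * g y z.2) ∂(ρ.prod ρ) := by
    simp only [e1]
    rw [integral_integral_swap]
    exact integrable_of_mem_Icc hm3 hm3'
  have hle : ∀ᵐ x ∂ρ, g.degree x ≤ a := (ae_restrict_iff' h.measurableSet.compl).2 h.degree_le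
  have hpt : ∀ᵐ z ∂(ρ.prod ρ), ∫ y in P, g y z.1 * g y z.2 ≤
      a⁻¹ * (g.degree z.1 * g.degree z.2) + 1 / 2 * (g.degree z.1 - a⁻¹ * g.degree z.1 ^ 2)
        + 1 / 2 * (g.degree z.2 - a⁻¹ * g.degree z.2 ^ 2) := by
    filter_upwards [Measure.quasiMeasurePreserving_fst.ae hle,
      Measure.quasiMeasurePreserving_snd.ae hle] with z h1 h2
    have hint : Integrable (fun y => g y z.1 * g y z.2) (volume.restrict P) :=
      integrable_of_mem_Icc (hm3.comp (measurable_id.prodMk measurable_const)) fun y => hm3' (y, z)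
    have hb1 : ∫ y in P, g y z.1 * g y z.2 ≤ g.degree z.1 := by
      refine (integral_mono hint (g.section_integrable z.1).integrableOn fun y => ?_).trans
        (g.partialDegree_le_degree P z.1)
      simp only [g.symm' y z.1]
      exact mul_le_of_le_one_right (g.mem' _ _).1 (g.mem' _ _).2
    have hb2 : ∫ y in P, g y z.1 * g y z.2 ≤ g.degree z.2 := by
      refine (integral_mono hint (g.section_integrable z.2).integrableOn fun y => ?_).trans
        (g.partialDegree_le_degree P z.2)
      simp only [g.symm' y z.2]
      exact mul_le_of_le_one_left (g.mem' _ _).1 (g.mem' _ _).2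
    exact kernel_le ha hb1 hb2 (g.degree_mem _).1 (g.degree_mem _).1 h1 h2
  set H : unitInterval → ℝ := fun x => g.degree x - a⁻¹ * g.degree x ^ 2 with hH
  have hHi : Integrable H ρ := g.integrable_degree.sub ((g.integrable_degree_pow 2).const_mul _)
  have hi1 : Integrable (fun z : unitInterval × unitInterval =>
      a⁻¹ * (g.degree z.1 * g.degree z.2)) (ρ.prod ρ) :=
    (g.integrable_degree.mul_prod g.integrable_degree).const_mul _
  have hi2 : Integrable (fun z : unitInterval × unitInterval => 1 / 2 * H z.1) (ρ.prod ρ) :=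
    (hHi.comp_fst ρ).const_mul _
  have hi3 : Integrable (fun z : unitInterval × unitInterval => 1 / 2 * H z.2) (ρ.prod ρ) :=
    (hHi.comp_snd ρ).const_mul _
  have hiL : Integrable (fun z : unitInterval × unitInterval =>
      ∫ y in P, g y z.1 * g y z.2) (ρ.prod ρ) :=
    (integrable_of_mem_Icc (μ := (volume.restrict P).prod (ρ.prod ρ)) hm3 hm3').integral_prod_right
  have hmono := integral_mono_ae hiL ((hi1.add hi2).add hi3) hpt
  rw [e2]
  refine hmono.trans_eq ?_
  have f1 : ∫ z : unitInterval × unitInterval, H z.1 ∂(ρ.prod ρ) = (∫ x, H x ∂ρ) * (1 - a) := by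
    have := integral_prod_mul (μ := ρ) (ν := ρ) H (fun _ => (1 : ℝ))
    simpa [hρu] using this
  have f2 : ∫ z : unitInterval × unitInterval, H z.2 ∂(ρ.prod ρ) = (1 - a) * (∫ x, H x ∂ρ) := by
    have := integral_prod_mul (μ := ρ) (ν := ρ) (fun _ => (1 : ℝ)) H
    simpa [hρu] using this
  have f3 : ∫ x, H x ∂ρ = (∫ x, g.degree x ∂ρ) - a⁻¹ * ∫ x, g.degree x ^ 2 ∂ρ := by
    rw [hH, integral_sub g.integrable_degree ((g.integrable_degree_pow 2).const_mul _),
      integral_const_mul]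
  have f0 : ∫ z : unitInterval × unitInterval, (((fun z : unitInterval × unitInterval => a⁻¹ * (g.degree z.1 * g.degree z.2))
      + fun z : unitInterval × unitInterval => 1 / 2 * H z.1)
      + fun z : unitInterval × unitInterval => 1 / 2 * H z.2) z ∂(ρ.prod ρ)
      = a⁻¹ * ((∫ x, g.degree x ∂ρ) * ∫ x, g.degree x ∂ρ)
        + 1 / 2 * ((∫ x, H x ∂ρ) * (1 - a)) + 1 / 2 * ((1 - a) * ∫ x, H x ∂ρ) := by
    rw [integral_add' (hi1.add hi2) hi3, integral_add' hi1 hi2, integral_const_mul,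
      integral_const_mul, integral_const_mul, f1, f2, integral_prod_mul]
  rw [f0, f3]
  ring

lemma integral_partialDegree_le (g : Graphon) (P : Set unitInterval) :
    ∫ x in P, g.partialDegree Pᶜ x ≤ ∫ x in Pᶜ, g.degree x := by
  rw [g.integral_partialDegree_comm]
  exact integral_mono (g.integrable_partialDegree P) g.integrable_degree
    (g.partialDegree_le_degree P)

namespace IsCore

lemma sq_measureReal_le (h : g.IsCore P) :
    volume.real P ^ 2 ≤ ∫ x in P, g.degree x := by
  calc volume.real P ^ 2 = ∫ _ in P, volume.real P := by
        rw [setIntegral_const, smul_eq_mul, sq]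
    _ ≤ _ := integral_mono_ae (integrable_const _) g.integrable_degree
        ((ae_restrict_iff' h.measurableSet).2 h.le_degree)

/-- On P, 0 ≤ d - a ≤ `partialDegree Pᶜ`, so d² ≤ 2ad - a² plus the square of the latter. After
inserting `integral_sq_partialDegree_le`, the integral of d² over the complement has coefficient (2a
- 1)/a. It is nonnegative because a ≥ 1/2, so d² ≤ ad off P finishes. -/
lemma two_star_le (h : g.IsCore P) (ha : 1 / 2 ≤ volume.real P) :
    g.starDensity 2 ≤ 2 * volume.real P * g.starDensity 1 - volume.real P ^ 3
      - volume.real P * (∫ x in Pᶜ, g.degree x)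
      + (∫ x in Pᶜ, g.degree x) ^ 2 / volume.real P := by
  have hsq := h.integral_sq_partialDegree_le (by linarith)
  rw [g.starDensity_eq_add 2 h.measurableSet, g.starDensity_one_eq_add h.measurableSet]
  set a := volume.real P with hadef
  set ω := ∫ x in Pᶜ, g.degree x
  set p := ∫ x in P, g.degree x with hp
  have ha0 : 0 < a := by linarith
  have h1 : ∫ x in P, g.degree x ^ 2 ≤ 2 * a * p - a ^ 3 + ∫ y in P, g.partialDegree Pᶜ y ^ 2 := by
    have hi1 : Integrable (fun x => 2 * a * g.degree x - a ^ 2) (volume.restrict P) :=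
      (g.integrable_degree.const_mul _).sub (integrable_const _)
    calc ∫ x in P, g.degree x ^ 2
        ≤ ∫ x in P, (2 * a * g.degree x - a ^ 2 + g.partialDegree Pᶜ x ^ 2) := by
          refine integral_mono_ae (g.integrable_degree_pow 2)
            (hi1.add (g.integrable_partialDegree_sq _)) ?_
          filter_upwards [(ae_restrict_iff' h.measurableSet).2 h.le_degree] with x hx
          have h2 := g.partialDegree_add_compl h.measurableSet x
          have h3 := g.partialDegree_le_measureReal P x
          nlinarith
      _ = _ := by
          rw [integral_add hi1 (g.integrable_partialDegree_sq _),
            integral_sub (g.integrable_degree.const_mul _) (integrable_const _),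
            integral_const_mul, setIntegral_const, smul_eq_mul, ← hadef, ← hp]
          ring
  have h2 : ∫ x in Pᶜ, g.degree x ^ 2 ≤ a * ω := by
    rw [← integral_const_mul]
    refine integral_mono_ae (g.integrable_degree_pow 2) (g.integrable_degree.const_mul _) ?_
    filter_upwards [(ae_restrict_iff' h.measurableSet.compl).2 h.degree_le] with x hx
    have := (g.degree_mem x).1
    nlinarith
  set F := ∫ x in Pᶜ, g.degree x ^ 2
  have h3 : (2 * a - 1) * (a⁻¹ * F) ≤ (2 * a - 1) * ω := by
    refine mul_le_mul_of_nonneg_left ?_ (by linarith)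
    rw [inv_mul_le_iff₀ ha0]; exact h2
  have h4 : F = a * (a⁻¹ * F) := by field_simp
  have h5 : ω ^ 2 / a = a⁻¹ * ω ^ 2 := by field_simp
  rw [h5]
  linarith

/-- A chord bound: d² ≤ (1 + a)d - a where a ≤ d ≤ 1, and d² ≤ ad off P. It is the useful bound when
the complement of P carries much degree. -/
lemma two_star_le' (h : g.IsCore P) :
    g.starDensity 2 ≤ (1 + volume.real P) * g.starDensity 1 - volume.real P ^ 2
      - ∫ x in Pᶜ, g.degree x := by
  rw [g.starDensity_eq_add 2 h.measurableSet, g.starDensity_one_eq_add h.measurableSet]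
  set a := volume.real P with hadef
  set ω := ∫ x in Pᶜ, g.degree x
  set p := ∫ x in P, g.degree x with hp
  have h1 : ∫ x in P, g.degree x ^ 2 ≤ (1 + a) * p - a ^ 2 := by
    calc ∫ x in P, g.degree x ^ 2 ≤ ∫ x in P, ((1 + a) * g.degree x - a) := by
          refine integral_mono_ae (g.integrable_degree_pow 2)
            ((g.integrable_degree.const_mul _).sub (integrable_const _)) ?_
          filter_upwards [(ae_restrict_iff' h.measurableSet).2 h.le_degree] with x hx
          have := (g.degree_mem x).2
          nlinarith
      _ = _ := by
          rw [integral_sub (g.integrable_degree.const_mul _) (integrable_const _),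
            integral_const_mul, setIntegral_const, smul_eq_mul, ← hadef, ← hp]
          ring
  have h2 : ∫ x in Pᶜ, g.degree x ^ 2 ≤ a * ω := by
    rw [← integral_const_mul]
    refine integral_mono_ae (g.integrable_degree_pow 2) (g.integrable_degree.const_mul _) ?_
    filter_upwards [(ae_restrict_iff' h.measurableSet.compl).2 h.degree_le] with x hx
    have := (g.degree_mem x).1
    nlinarith
  linarith

lemma integral_partialDegree_self (h : g.IsCore P) :
    ∫ x in P, g.partialDegree P x
      = (∫ x in P, g.degree x) - ∫ x in P, g.partialDegree Pᶜ x := by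
  rw [← integral_sub g.integrable_degree (g.integrable_partialDegree _)]
  refine integral_congr_ae (ae_of_all _ fun x => ?_)
  simp only [← g.partialDegree_add_compl h.measurableSet x]
  ring

/-- Edges inside P contribute at most a²; edges with an end outside P are counted at most twice by
the degrees outside P. -/
lemma le_add_two_mul (h : g.IsCore P) :
    g.starDensity 1 ≤ volume.real P ^ 2 + 2 * ∫ x in Pᶜ, g.degree x := by
  have h1 := g.integral_partialDegree_le P
  have h2 := h.integral_partialDegree_self
  have h3 : ∫ x in P, g.partialDegree P x ≤ volume.real P ^ 2 := by
    calc ∫ x in P, g.partialDegree P x ≤ ∫ _ in P, volume.real P :=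
          integral_mono (g.integrable_partialDegree P) (integrable_const _)
            (g.partialDegree_le_measureReal P)
      _ = _ := by rw [setIntegral_const, smul_eq_mul, sq]
  rw [g.starDensity_one_eq_add h.measurableSet]
  linarith

lemma integral_compl_degree_le (h : g.IsCore P) :
    ∫ x in Pᶜ, g.degree x ≤ g.starDensity 1 - volume.real P ^ 2 := by
  have := h.sq_measureReal_le
  rw [g.starDensity_one_eq_add h.measurableSet]
  linarith

end IsCore

/-- The gain of the clique over the other graphons with a large core. -/
lemma clique_gap {r a w t : ℝ} (hr : r ∈ Icc (0.7 : ℝ) 0.715) (ha : 1 / 2 ≤ a) (har : a ≤ r)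
    (hw : r ^ 2 ≤ a ^ 2 + 2 * w)
    (h1 : t ≤ 2 * a * r ^ 2 - a ^ 3 - a * w + w ^ 2 / a)
    (h2 : t ≤ (1 + a) * r ^ 2 - a ^ 2 - w) :
    t ≤ r ^ 3 - (r - a) ^ 2 / 100 := by
  obtain ⟨hr1, hr2⟩ := hr
  have ha0 : 0 < a := by linarith
  have hD : 0 ≤ r - a := by linarith
  -- For large w the bound `h2` suffices: it leaves a deficit of at least (r - a)(r² - (r + a)/3),
  -- where r > 2/3 matters. For small w, write w as its least value (r² - a²)/2 plus v and use `h1`.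
  by_cases hv : 2 / 3 * (r ^ 2 - a ^ 2) ≤ w
  · have h3 : (r - a) / 100 ≤ r ^ 2 - (r + a) / 3 := by nlinarith
    have h4 := mul_le_mul_of_nonneg_left h3 hD
    nlinarith
  · push Not at hv
    obtain ⟨v, rfl⟩ : ∃ v, w = (r ^ 2 - a ^ 2) / 2 + v := ⟨w - (r ^ 2 - a ^ 2) / 2, by ring⟩
    have hv0 : 0 ≤ v := by linarith
    have hv1 : v ≤ (r - a) * (r + a) / 6 := by nlinarith
    have hq : 0.4 ≤ a ^ 2 + 2 * a * r - r ^ 2 - 0.04 * a := by nlinarith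
    have key : 0 ≤ (r - a) ^ 2 * (a ^ 2 + 2 * a * r - r ^ 2 - 0.04 * a)
        + 4 * v * (2 * a ^ 2 - r ^ 2 - v) := by
      -- Since v ≤ (r² - a²)/6, the factor 2a² - r² - v is at least (13a² - 7r²)/6. When this is
      -- negative, r - a is so large that the first term dominates.
      rcases le_total (7 * r ^ 2) (13 * a ^ 2) with h | h
      · have : 0 ≤ 2 * a ^ 2 - r ^ 2 - v := by nlinarith
        positivity
      · have ha1 : a ≤ 0.5255 := by nlinarith
        have h5 : (r - a) ^ 2 * 0.4 ≤ (r - a) ^ 2 * (a ^ 2 + 2 * a * r - r ^ 2 - 0.04 * a) :=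
          mul_le_mul_of_nonneg_left hq (sq_nonneg _)
        have h6 : -0.055 ≤ 2 * a ^ 2 - r ^ 2 - v := by nlinarith
        have h7 : v ≤ (r - a) * 1.25 / 6 := hv1.trans (by nlinarith)
        have h8 : 4 * v * (-0.055) ≤ 4 * v * (2 * a ^ 2 - r ^ 2 - v) :=
          mul_le_mul_of_nonneg_left h6 (by linarith)
        nlinarith
    have h1' : t ≤ r ^ 3 - (r - a) ^ 2 / 100
        - ((r - a) ^ 2 * (a ^ 2 + 2 * a * r - r ^ 2 - 0.04 * a)
        + 4 * v * (2 * a ^ 2 - r ^ 2 - v)) / (4 * a) := by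
      refine h1.trans (le_of_eq ?_)
      field_simp
      ring
    have : 0 ≤ ((r - a) ^ 2 * (a ^ 2 + 2 * a * r - r ^ 2 - 0.04 * a)
        + 4 * v * (2 * a ^ 2 - r ^ 2 - v)) / (4 * a) := by positivity
    linarith

end Graphon

/-! ### Diagonal crossing and complementation -/

namespace Graphon

/-- A decreasing function on the unit interval crosses the diagonal. -/
lemma exists_diagonal_crossing {q : unitInterval → ℝ} (hq : Antitone q)
    (hq' : ∀ x, q x ∈ Icc (0 : ℝ) 1) :
    ∃ a : unitInterval, (∀ x < a, (a : ℝ) ≤ q x) ∧ ∀ x, a < x → q x ≤ a := by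
  set A : Set ℝ := {x | ∃ hx : x ∈ unitInterval, x ≤ q ⟨x, hx⟩} with hA
  have h0 : (0 : ℝ) ∈ A := ⟨⟨le_rfl, zero_le_one⟩, (hq' _).1⟩
  have hb : BddAbove A := ⟨1, fun x hx => hx.1.2⟩
  have ha : sSup A ∈ unitInterval := ⟨le_csSup hb h0, csSup_le ⟨0, h0⟩ fun x hx => hx.1.2⟩
  refine ⟨⟨sSup A, ha⟩, fun x hx => ?_, fun x hx => ?_⟩
  · refine csSup_le ⟨0, h0⟩ fun y hy => ?_
    have hx' : (x : ℝ) < sSup A := hx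
    obtain ⟨z, ⟨hz, hzq⟩, hxz⟩ := exists_lt_of_lt_csSup ⟨0, h0⟩ hx'
    rcases le_total y z with h | h
    · exact h.trans (hzq.trans (hq (show x ≤ ⟨z, hz⟩ from hxz.le)))
    · obtain ⟨hy, hyq⟩ := hy
      exact hyq.trans (hq (show x ≤ ⟨y, hy⟩ from hxz.le.trans h))
  · by_contra! hlt
    obtain ⟨y, hy1, hy2⟩ := exists_between (lt_min hx hlt : sSup A < min (x : ℝ) (q x))
    have hyI : y ∈ unitInterval := ⟨ha.1.trans hy1.le, (hy2.le.trans (min_le_left _ _)).trans x.2.2⟩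
    refine absurd (le_csSup hb (show y ∈ A from ⟨hyI, ?_⟩)) (not_le.2 hy1)
    exact (hy2.le.trans (min_le_right _ _)).trans
      (hq (show (⟨y, hyI⟩ : unitInterval) ≤ x from hy2.le.trans (min_le_left _ _)))

lemma volume_real_Iio (a : unitInterval) : volume.real (Iio a) = a := by
  rw [measureReal_def, unitInterval.volume_Iio, ENNReal.toReal_ofReal a.2.1]

lemma HasAntitoneDegree.exists_isCore {g : Graphon} {q : unitInterval → ℝ}
    (h : g.HasAntitoneDegree q) : ∃ a : unitInterval, g.IsCore (Iio a) := by
  obtain ⟨a, h1, h2⟩ := exists_diagonal_crossing h.antitone h.mem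
  have hne : ∀ᵐ x : unitInterval, x ≠ a := by
    rw [ae_iff]
    simp
  refine ⟨a, measurableSet_Iio, ?_, ?_⟩
  · filter_upwards [h.ae_eq] with x hx hxa
    rw [hx, volume_real_Iio]; exact h1 x hxa
  · filter_upwards [h.ae_eq, hne] with x hx hne hxa
    rw [hx, volume_real_Iio]
    exact h2 x (lt_of_le_of_ne (not_lt.1 hxa) hne.symm)

/-- The complement of `g`, with the unit interval reversed. -/
noncomputable def reverseCompl (g : Graphon) : Graphon where
  toFun x y := 1 - g (unitInterval.symm x) (unitInterval.symm y)
  symm' x y := by rw [g.symm']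
  mem' x y := by
    have := g.mem' (unitInterval.symm x) (unitInterval.symm y)
    exact ⟨by linarith [this.2], by linarith [this.1]⟩
  measurable' := Measurable.const_sub (g.measurable'.comp
    ((unitInterval.measurable_symm.comp measurable_fst).prodMk
      (unitInterval.measurable_symm.comp measurable_snd))) 1

lemma reverseCompl_apply (g : Graphon) (x y : unitInterval) :
    g.reverseCompl x y = 1 - g (unitInterval.symm x) (unitInterval.symm y) := rfl

lemma integral_comp_symm (f : unitInterval → ℝ) :
    ∫ x, f (unitInterval.symm x) = ∫ x, f x :=
  unitInterval.measurePreserving_symm.integral_comp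
    unitInterval.symmMeasurableEquiv.measurableEmbedding f

lemma integral_comp_symm_prod (f : unitInterval × unitInterval → ℝ) :
    ∫ p : unitInterval × unitInterval, f (unitInterval.symm p.1, unitInterval.symm p.2)
      = ∫ p, f p :=
  (unitInterval.measurePreserving_symm.prod unitInterval.measurePreserving_symm).integral_comp
    (unitInterval.symmMeasurableEquiv.prodCongr
      unitInterval.symmMeasurableEquiv).measurableEmbedding f

lemma degree_reverseCompl (g : Graphon) (x : unitInterval) :
    g.reverseCompl.degree x = 1 - g.degree (unitInterval.symm x) := by
  unfold degree
  simp only [reverseCompl_apply]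
  rw [integral_comp_symm fun y => 1 - g (unitInterval.symm x) y,
    integral_sub (integrable_const _) (g.section_integrable _)]
  simp

lemma starDensity_reverseCompl (g : Graphon) (k : ℕ) :
    g.reverseCompl.starDensity k = ∫ x, (1 - g.degree x) ^ k := by
  unfold starDensity
  simp only [degree_reverseCompl]
  exact integral_comp_symm fun x => (1 - g.degree x) ^ k

lemma starDensity_one_reverseCompl (g : Graphon) :
    g.reverseCompl.starDensity 1 = 1 - g.starDensity 1 := by
  rw [starDensity_reverseCompl]
  simp only [pow_one, starDensity]
  rw [integral_sub (integrable_const _) g.integrable_degree]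
  simp

lemma starDensity_two_reverseCompl (g : Graphon) :
    g.reverseCompl.starDensity 2 = 1 - 2 * g.starDensity 1 + g.starDensity 2 := by
  rw [starDensity_reverseCompl]
  have e : ∀ x, (1 - g.degree x) ^ 2 = 1 - 2 * g.degree x ^ 1 + g.degree x ^ 2 := fun x => by ring
  simp only [e]
  have h1 := (g.integrable_degree_pow 1 (μ := volume)).const_mul 2
  have h2 := g.integrable_degree_pow 2 (μ := volume)
  have h0 : Integrable (fun _ : unitInterval => (1 : ℝ)) := integrable_const _
  have h01 : Integrable (fun x => 1 - 2 * g.degree x ^ 1) := h0.sub h1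
  rw [integral_add h01 h2, integral_sub h0 h1, integral_const_mul]
  simp [starDensity]

lemma starDensity_three_reverseCompl (g : Graphon) :
    g.reverseCompl.starDensity 3
      = 1 - 3 * g.starDensity 1 + 3 * g.starDensity 2 - g.starDensity 3 := by
  rw [starDensity_reverseCompl]
  have e : ∀ x, (1 - g.degree x) ^ 3
      = 1 - 3 * g.degree x ^ 1 + 3 * g.degree x ^ 2 - g.degree x ^ 3 := fun x => by ring
  simp only [e]
  have h1 := (g.integrable_degree_pow 1 (μ := volume)).const_mul 3
  have h2 := (g.integrable_degree_pow 2 (μ := volume)).const_mul 3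
  have h3 := g.integrable_degree_pow 3 (μ := volume)
  have h0 : Integrable (fun _ : unitInterval => (1 : ℝ)) := integrable_const _
  have h01 : Integrable (fun x => 1 - 3 * g.degree x ^ 1) := h0.sub h1
  have h012 : Integrable (fun x => 1 - 3 * g.degree x ^ 1 + 3 * g.degree x ^ 2) := h01.add h2
  rw [integral_sub h012 h3, integral_add h01 h2, integral_sub h0 h1,
    integral_const_mul, integral_const_mul]
  simp [starDensity]

lemma entropy_reverseCompl (g : Graphon) : g.reverseCompl.entropy = g.entropy := by
  unfold entropy
  simp only [reverseCompl_apply, Real.binEntropy_one_sub]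
  rw [integral_comp_symm_prod fun p => Real.binEntropy (g p.1 p.2)]

lemma IsMaximizer.reverseCompl {g : Graphon} {t : ℝ} (h : g.IsMaximizer (1 / 2, t)) :
    g.reverseCompl.IsMaximizer (1 / 2, t) := by
  have hden : ∀ f : Graphon, f.densities = (1 / 2, t) → f.reverseCompl.densities = (1 / 2, t) := by
    intro f hf
    have h1 : f.starDensity 1 = 1 / 2 := congrArg Prod.fst hf
    have h2 : f.starDensity 2 = t := congrArg Prod.snd hf
    refine Prod.ext ?_ ?_
    · change f.reverseCompl.starDensity 1 = 1 / 2
      rw [starDensity_one_reverseCompl, h1]; norm_num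
    · change f.reverseCompl.starDensity 2 = t
      rw [starDensity_two_reverseCompl, h1, h2]; ring
  refine ⟨hden g h.1, fun f hf => ?_⟩
  rw [entropy_reverseCompl, ← entropy_reverseCompl f]
  exact h.2 _ (hden f hf)

/-- Degrees d become 1 - d, so the old complement, of measure 1 - a, is the new core; reversing the
interval makes it an initial segment again, up to a null set. -/
lemma IsCore.reverseCompl {g : Graphon} {a : unitInterval} (h : g.IsCore (Iio a)) :
    g.reverseCompl.IsCore (Iio (unitInterval.symm a)) := by
  have hq := unitInterval.measurePreserving_symm.quasiMeasurePreserving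
  have hne : ∀ᵐ x : unitInterval, x ≠ unitInterval.symm a := by
    rw [ae_iff]
    simp
  refine ⟨measurableSet_Iio, ?_, ?_⟩
  · filter_upwards [hq.ae h.degree_le] with x hx hxa
    rw [degree_reverseCompl, volume_real_Iio, unitInterval.coe_symm_eq]
    have := hx (by
      have : a < unitInterval.symm x := unitInterval.lt_symm_comm.1 hxa
      exact not_lt.2 this.le)
    rw [volume_real_Iio] at this
    linarith
  · filter_upwards [hq.ae h.le_degree, hne] with x hx hne hxa
    rw [degree_reverseCompl, volume_real_Iio, unitInterval.coe_symm_eq]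
    have := hx (unitInterval.symm_lt_comm.1 (lt_of_le_of_ne (not_lt.1 hxa) hne.symm))
    rw [volume_real_Iio] at this
    linarith

/-- Up to complementation, the core has measure at least `1/2`. -/
lemma HasAntitoneDegree.exists_large_core {g : Graphon} {q : unitInterval → ℝ}
    (h : g.HasAntitoneDegree q) :
    (∃ a : unitInterval, 1 / 2 ≤ (a : ℝ) ∧ g.IsCore (Iio a)) ∨
      ∃ a : unitInterval, 1 / 2 ≤ (a : ℝ) ∧ g.reverseCompl.IsCore (Iio a) := by
  obtain ⟨a, ha⟩ := h.exists_isCore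
  rcases le_total (1 / 2 : ℝ) a with h2 | h2
  · exact Or.inl ⟨a, h2, ha⟩
  · refine Or.inr ⟨unitInterval.symm a, ?_, ha.reverseCompl⟩
    rw [unitInterval.coe_symm_eq]; linarith

/-! ### Stability: closeness to the clique -/

namespace IsCore

variable {g : Graphon} {P : Set unitInterval}

lemma sq_le (h : g.IsCore P) : volume.real P ^ 2 ≤ g.starDensity 1 := by
  have h1 := h.integral_compl_degree_le
  have h2 : 0 ≤ ∫ x in Pᶜ, g.degree x := integral_nonneg fun x => (g.degree_mem x).1
  linarith

/-- Graphons with a large core have at most as many 2-stars as the clique. -/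
lemma two_star_le_clique (h : g.IsCore P) (ha : 1 / 2 ≤ volume.real P) {r : ℝ}
    (hr : r ∈ Icc (0.7 : ℝ) 0.715) (hr2 : g.starDensity 1 = r ^ 2) :
    g.starDensity 2 ≤ r ^ 3 - (r - volume.real P) ^ 2 / 100 := by
  have h1 := h.two_star_le ha
  have h2 := h.two_star_le'
  have h3 := h.le_add_two_mul
  have h4 := h.sq_le
  rw [hr2] at h1 h2 h3 h4
  exact clique_gap hr ha (le_of_sq_le_sq h4 (by linarith [hr.1])) h3 h1 h2

/-- On P, d³ ≤ a³ + 3(d - a), and off P, d³ ≤ d. Once a² is close to the edge density, this is close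
to the value a⁴ of a clique. -/
lemma three_star_le (h : g.IsCore P) :
    g.starDensity 3 ≤ volume.real P ^ 4 + 3 * (g.starDensity 1 - volume.real P ^ 2) := by
  have hs := h.sq_measureReal_le
  rw [g.starDensity_eq_add 3 h.measurableSet, g.starDensity_one_eq_add h.measurableSet]
  set a := volume.real P with hadef
  set p := ∫ x in P, g.degree x with hp
  have h0 : 0 ≤ ∫ x in Pᶜ, g.degree x := integral_nonneg fun x => (g.degree_mem x).1
  have hi : Integrable (fun x => 3 * g.degree x + (a ^ 3 - 3 * a)) (volume.restrict P) :=
    (g.integrable_degree.const_mul _).add (integrable_const _)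
  have h1 : ∫ x in P, g.degree x ^ 3 ≤ a ^ 4 + 3 * (p - a ^ 2) := by
    calc ∫ x in P, g.degree x ^ 3 ≤ ∫ x in P, (3 * g.degree x + (a ^ 3 - 3 * a)) := by
          refine integral_mono_ae (g.integrable_degree_pow 3) hi ?_
          filter_upwards [(ae_restrict_iff' h.measurableSet).2 h.le_degree] with x hx
          have h1 := (g.degree_mem x).2
          have ha0 : 0 ≤ a := measureReal_nonneg
          have h2 : g.degree x ^ 2 + g.degree x * a + a ^ 2 ≤ 3 := by nlinarith
          nlinarith [mul_le_mul_of_nonneg_left h2 (sub_nonneg.2 hx)]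
      _ = _ := by
          rw [integral_add (g.integrable_degree.const_mul _) (integrable_const _),
            integral_const_mul, setIntegral_const, smul_eq_mul, ← hadef, ← hp]
          ring
  have h2 : ∫ x in Pᶜ, g.degree x ^ 3 ≤ ∫ x in Pᶜ, g.degree x := by
    refine integral_mono (g.integrable_degree_pow 3) g.integrable_degree fun x => ?_
    exact pow_le_of_le_one (g.degree_mem x).1 (g.degree_mem x).2 (by norm_num)
  linarith

end IsCore

lemma degree_clique (c x : unitInterval) :
    (clique c).degree x = if x < c then (c : ℝ) else 0 := by
  have : ∀ y, (clique c) x y = (if x < c then (1 : ℝ) else 0) * (Iio c).indicator 1 y := by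
    intro y
    simp only [clique, Subtype.coe_lt_coe, indicator, mem_Iio, Pi.one_apply]
    split_ifs <;> simp_all
  unfold degree
  simp only [this]
  rw [integral_const_mul, integral_indicator_one measurableSet_Iio, volume_real_Iio]
  split_ifs <;> simp

lemma starDensity_clique (c : unitInterval) {k : ℕ} (hk : k ≠ 0) :
    (clique c).starDensity k = (c : ℝ) ^ (k + 1) := by
  have : ∀ x, (clique c).degree x ^ k = (c : ℝ) ^ k * (Iio c).indicator 1 x := by
    intro x
    simp only [degree_clique, indicator, mem_Iio, Pi.one_apply]
    split_ifs <;> simp [hk]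
  unfold starDensity
  simp only [this]
  rw [integral_const_mul, integral_indicator_one measurableSet_Iio, volume_real_Iio, pow_succ]

lemma integrable_uncurry (g : Graphon) {μ : Measure (unitInterval × unitInterval)}
    [IsFiniteMeasure μ] : Integrable (fun p : unitInterval × unitInterval => g p.1 p.2) μ :=
  integrable_of_mem_Icc g.measurable' fun p => g.mem' p.1 p.2

lemma integral_eq_starDensity_one (g : Graphon) :
    ∫ p : unitInterval × unitInterval, g p.1 p.2 = g.starDensity 1 := by
  rw [Measure.volume_eq_prod, integral_prod _ (g.integrable_uncurry (μ := volume.prod volume))]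
  simp only [starDensity, pow_one]; rfl

/-- The `L¹` distance from a graphon with a large core to the clique. -/
lemma IsCore.integral_abs_sub_clique_le {g : Graphon} {a c : unitInterval} (h : g.IsCore (Iio a))
    (hc : g.starDensity 1 = (c : ℝ) ^ 2) :
    ∫ p : unitInterval × unitInterval, |g p.1 p.2 - (clique c) p.1 p.2|
      ≤ 4 * ((c : ℝ) ^ 2 - (a : ℝ) ^ 2) := by
  have hsq := h.sq_le
  have hω := h.integral_compl_degree_le
  have hp := g.starDensity_one_eq_add h.measurableSet
  have h1 := h.integral_partialDegree_self
  have h2 := g.integral_partialDegree_le (Iio a)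
  rw [volume_real_Iio, hc] at hsq hω
  rw [hc] at hp
  have hac' : (a : ℝ) ≤ c := le_of_sq_le_sq hsq c.2.1
  have hac : a ≤ c := hac'
  set R : Set (unitInterval × unitInterval) := Iio a ×ˢ Iio a with hR
  have hRm : MeasurableSet R := measurableSet_Iio.prod measurableSet_Iio
  have hRi : ∫ p in R, g p.1 p.2 = ∫ x in Iio a, g.partialDegree (Iio a) x := by
    rw [Measure.volume_eq_prod, hR, setIntegral_prod _ g.integrable_uncurry.integrableOn]; rfl
  have hi : Integrable (fun p : unitInterval × unitInterval =>
      R.indicator (fun p => g p.1 p.2) p) := g.integrable_uncurry.indicator hRm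
  -- On R the clique equals 1, so the distance is 1 - g; elsewhere g plus the clique bounds it. It
  -- remains to bound the mass of g on R below, by c² - 2(c² - a²).
  have hpt : ∀ p : unitInterval × unitInterval, |g p.1 p.2 - (clique c) p.1 p.2|
      ≤ g p.1 p.2 + (clique c) p.1 p.2 - 2 * R.indicator (fun p => g p.1 p.2) p := by
    intro p
    have hg := g.mem' p.1 p.2
    by_cases hp : p ∈ R
    · have : (clique c) p.1 p.2 = 1 := if_pos ⟨hp.1.trans_le hac, hp.2.trans_le hac⟩
      rw [this, indicator_of_mem hp, abs_of_nonpos (by linarith [hg.2])]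
      linarith
    · rw [indicator_of_notMem hp]
      have hcl := (clique c).mem' p.1 p.2
      rw [abs_le]
      constructor <;> linarith [hg.1, hcl.1]
  have hmono := integral_mono (((g.integrable_uncurry (μ := volume)).sub
    (clique c).integrable_uncurry).abs) ((g.integrable_uncurry.add
    (clique c).integrable_uncurry).sub (hi.const_mul 2)) hpt
  refine hmono.trans ?_
  have e : ∫ p : unitInterval × unitInterval, (g p.1 p.2 + (clique c) p.1 p.2
      - 2 * R.indicator (fun p => g p.1 p.2) p)
      = 2 * (c : ℝ) ^ 2 - 2 * ∫ x in Iio a, g.partialDegree (Iio a) x := by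
    have hi2 : Integrable (fun p : unitInterval × unitInterval =>
        g p.1 p.2 + (clique c) p.1 p.2) :=
      g.integrable_uncurry.add (clique c).integrable_uncurry
    rw [integral_sub hi2 (hi.const_mul 2), integral_add g.integrable_uncurry (clique c).integrable_uncurry, integral_const_mul,
      integral_indicator hRm, hRi, integral_eq_starDensity_one, integral_eq_starDensity_one, hc,
      starDensity_clique c one_ne_zero]
    ring
  refine e.le.trans ?_
  linarith

end Graphon

/-! ### Star densities, equivalence and the cut metric -/

namespace Graphon

lemma starDensity_relabel (g : Graphon) {ψ : unitInterval → unitInterval}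
    (hψ : MeasurePreserving ψ volume volume) (k : ℕ) :
    (g.relabel ψ hψ.measurable).starDensity k = g.starDensity k := by
  have hd : ∀ x, (g.relabel ψ hψ.measurable).degree x = g.degree (ψ x) := by
    intro x
    have := integral_map (μ := volume) (φ := ψ) (f := g (ψ x)) hψ.measurable.aemeasurable
      (g.section_measurable (ψ x)).aestronglyMeasurable
    rw [hψ.map_eq] at this
    exact this.symm
  have := integral_map (μ := volume) (φ := ψ) (f := fun x => g.degree x ^ k)
    hψ.measurable.aemeasurable (g.degree_measurable.pow_const k).aestronglyMeasurable
  rw [hψ.map_eq] at this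
  unfold starDensity
  simp only [hd, this]

lemma starDensity_congr_ae {g h : Graphon}
    (hgh : ∀ᵐ p : unitInterval × unitInterval, g p.1 p.2 = h p.1 p.2) (k : ℕ) :
    g.starDensity k = h.starDensity k := by
  rw [Measure.volume_eq_prod] at hgh
  refine integral_congr_ae ?_
  filter_upwards [Measure.ae_ae_of_ae_prod hgh] with x hx
  have : g.degree x = h.degree x := integral_congr_ae hx
  rw [this]

lemma Equivalent.starDensity_eq {g h : Graphon} (hgh : Equivalent g h) (k : ℕ) :
    g.starDensity k = h.starDensity k := by
  induction hgh with
  | rel x y hxy =>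
    obtain ⟨ψ, hψ, hae⟩ := hxy
    rw [starDensity_congr_ae hae, starDensity_relabel x hψ]
  | refl x => rfl
  | symm x y _ ih => exact ih.symm
  | trans x y z _ _ ih1 ih2 => exact ih1.trans ih2

lemma integrable_sub_uncurry (g h : Graphon) :
    Integrable fun p : unitInterval × unitInterval => g p.1 p.2 - h p.1 p.2 :=
  g.integrable_uncurry.sub h.integrable_uncurry

lemma abs_setIntegral_sub_le (g h : Graphon) (R : Set (unitInterval × unitInterval)) :
    |∫ p in R, (g p.1 p.2 - h p.1 p.2)|
      ≤ ∫ p : unitInterval × unitInterval, |g p.1 p.2 - h p.1 p.2| :=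
  abs_integral_le_integral_abs.trans
    (setIntegral_le_integral (g.integrable_sub_uncurry h).abs (ae_of_all _ fun _ => abs_nonneg _))

lemma cutNormDist_le_integral_abs (g h : Graphon) :
    cutNormDist g h ≤ ∫ p : unitInterval × unitInterval, |g p.1 p.2 - h p.1 p.2| := by
  refine csSup_le ⟨_, ∅, ∅, .empty, .empty, rfl⟩ ?_
  rintro _ ⟨S, T, -, -, rfl⟩
  exact g.abs_setIntegral_sub_le h _

lemma le_cutNormDist (g h : Graphon) {S T : Set unitInterval} (hS : MeasurableSet S)
    (hT : MeasurableSet T) : |∫ p in S ×ˢ T, (g p.1 p.2 - h p.1 p.2)| ≤ cutNormDist g h := by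
  refine le_csSup ⟨∫ p : unitInterval × unitInterval, |g p.1 p.2 - h p.1 p.2|, ?_⟩
    ⟨S, T, hS, hT, rfl⟩
  rintro _ ⟨S, T, -, -, rfl⟩
  exact g.abs_setIntegral_sub_le h _

lemma cutNormDist_nonneg (g h : Graphon) : 0 ≤ cutNormDist g h :=
  (abs_nonneg _).trans (g.le_cutNormDist h .empty .empty)

lemma cutDist_le_integral_abs (g h : Graphon) :
    cutDist g h ≤ ∫ p : unitInterval × unitInterval, |g p.1 p.2 - h p.1 p.2| := by
  refine le_trans (csInf_le ⟨0, ?_⟩ ⟨.refl _, .id _, rfl⟩) (cutNormDist_le_integral_abs g h)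
  rintro _ ⟨φ, hφ, rfl⟩
  exact cutNormDist_nonneg _ _

/-- Rectangles S × [0,1] test the degrees; the factor 2 comes from taking S where the difference is
nonnegative and then its complement. -/
lemma integral_abs_degree_sub_le (g h : Graphon) :
    ∫ x, |g.degree x - h.degree x| ≤ 2 * cutNormDist g h := by
  have hd : Integrable fun x => g.degree x - h.degree x :=
    g.integrable_degree.sub h.integrable_degree
  have key : ∀ S, MeasurableSet S → |∫ x in S, (g.degree x - h.degree x)| ≤ cutNormDist g h := by
    intro S hS
    have h1 := g.le_cutNormDist h hS MeasurableSet.univ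
    rw [Measure.volume_eq_prod, setIntegral_prod _ (g.integrable_sub_uncurry h).integrableOn] at h1
    have h2 : ∀ x, ∫ y in univ, (g x y - h x y) = g.degree x - h.degree x := by
      intro x
      rw [Measure.restrict_univ, integral_sub (g.section_integrable x) (h.section_integrable x)]
      rfl
    simpa only [h2] using h1
  set S := {x | h.degree x ≤ g.degree x} with hS
  have hSm : MeasurableSet S := measurableSet_le h.degree_measurable g.degree_measurable
  rw [← integral_add_compl hSm hd.abs]
  have e1 : ∫ x in S, |g.degree x - h.degree x| = ∫ x in S, (g.degree x - h.degree x) :=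
    setIntegral_congr_fun hSm fun x hx => abs_of_nonneg (sub_nonneg.2 hx)
  have e2 : ∫ x in Sᶜ, |g.degree x - h.degree x| = -∫ x in Sᶜ, (g.degree x - h.degree x) := by
    rw [← integral_neg]
    exact setIntegral_congr_fun hSm.compl fun x hx =>
      abs_of_nonpos (sub_nonpos.2 (not_le.1 (show ¬ h.degree x ≤ g.degree x from hx)).le)
  rw [e1, e2]
  have h1 := (abs_le.1 (key S hSm)).2
  have h2 := (abs_le.1 (key _ hSm.compl)).1
  linarith

lemma abs_starDensity_three_sub_le_cutNormDist (g h : Graphon) :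
    |g.starDensity 3 - h.starDensity 3| ≤ 6 * cutNormDist g h := by
  have hd : Integrable fun x => g.degree x - h.degree x :=
    g.integrable_degree.sub h.integrable_degree
  unfold starDensity
  rw [← integral_sub (g.integrable_degree_pow 3) (h.integrable_degree_pow 3)]
  calc |∫ x, (g.degree x ^ 3 - h.degree x ^ 3)|
      ≤ ∫ x, |g.degree x ^ 3 - h.degree x ^ 3| := abs_integral_le_integral_abs
    _ ≤ ∫ x, 3 * |g.degree x - h.degree x| := by
        refine integral_mono ((g.integrable_degree_pow 3).sub (h.integrable_degree_pow 3)).abs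
          (hd.abs.const_mul 3) fun x => ?_
        obtain ⟨h1, h2⟩ := g.degree_mem x
        obtain ⟨h3, h4⟩ := h.degree_mem x
        have e : g.degree x ^ 3 - h.degree x ^ 3 = (g.degree x ^ 2 + g.degree x * h.degree x
            + h.degree x ^ 2) * (g.degree x - h.degree x) := by ring
        simp only [e]
        rw [abs_mul]
        refine mul_le_mul_of_nonneg_right ?_ (abs_nonneg _)
        rw [abs_of_nonneg (by positivity)]
        nlinarith
    _ ≤ 6 * cutNormDist g h := by
        rw [integral_const_mul]
        linarith [g.integral_abs_degree_sub_le h]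

/-- The 3-star density is Lipschitz in the cut metric. -/
lemma abs_starDensity_three_sub_le_cutDist (g h : Graphon) :
    |g.starDensity 3 - h.starDensity 3| ≤ 6 * cutDist g h := by
  have : |g.starDensity 3 - h.starDensity 3| / 6 ≤ cutDist g h := by
    refine le_csInf ⟨_, .refl _, .id _, rfl⟩ ?_
    rintro _ ⟨φ, hφ, rfl⟩
    have := abs_starDensity_three_sub_le_cutNormDist g (h.relabel φ φ.measurable)
    rw [starDensity_relabel h hφ] at this
    linarith
  linarith

lemma CutContinuousOn.continuousOn_starDensity_three {G : ℝ × ℝ → Graphon} {A : Set (ℝ × ℝ)}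
    (hG : CutContinuousOn G A) : ContinuousOn (fun τ => (G τ).starDensity 3) A := by
  intro τ hτ
  refine tendsto_iff_dist_tendsto_zero.2 ?_
  have h6 : Tendsto (fun σ => 6 * cutDist (G σ) (G τ)) (𝓝[A] τ) (𝓝 0) := by
    simpa using (hG τ hτ).const_mul 6
  exact squeeze_zero (fun _ => dist_nonneg)
    (fun σ => abs_starDensity_three_sub_le_cutDist (G σ) (G τ)) h6

/-! ### The feasible region -/

/-- The convex combination of `g` with the constant graphon of the same edge density. -/
noncomputable def blend (g : Graphon) (s : unitInterval) : Graphon where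
  toFun x y := s * g x y + (1 - s) * g.starDensity 1
  symm' x y := by rw [g.symm']
  mem' x y := by
    have h1 := g.mem' x y
    have h2 : g.starDensity 1 ∈ Icc (0 : ℝ) 1 := by
      rw [← integral_eq_starDensity_one]
      refine ⟨integral_nonneg fun p => (g.mem' _ _).1, ?_⟩
      refine (integral_mono g.integrable_uncurry (integrable_const (1 : ℝ))
        fun p => (g.mem' _ _).2).trans (by simp)
    have hs := s.2
    exact (convex_Icc (0 : ℝ) 1) h1 h2 hs.1 (by linarith [hs.2]) (by ring)
  measurable' := Measurable.add_const (Measurable.const_mul g.measurable' _) _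

lemma degree_blend (g : Graphon) (s x : unitInterval) :
    (g.blend s).degree x = s * g.degree x + (1 - s) * g.starDensity 1 := by
  have : (g.blend s).degree x = ∫ y, (s * g x y + (1 - s) * g.starDensity 1) := rfl
  rw [this, integral_add ((g.section_integrable x).const_mul _) (integrable_const _),
    integral_const_mul]
  simp [degree]

lemma starDensity_one_blend (g : Graphon) (s : unitInterval) :
    (g.blend s).starDensity 1 = g.starDensity 1 := by
  have : (g.blend s).starDensity 1 = ∫ x, (s * g.degree x + (1 - s) * g.starDensity 1) := by
    simp only [starDensity, pow_one, degree_blend]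
  rw [this, integral_add (g.integrable_degree.const_mul _) (integrable_const _),
    integral_const_mul]
  simp only [starDensity, pow_one, integral_const, probReal_univ, smul_eq_mul]
  ring

lemma starDensity_two_blend (g : Graphon) (s : unitInterval) :
    (g.blend s).starDensity 2
      = g.starDensity 1 ^ 2 + (s : ℝ) ^ 2 * (g.starDensity 2 - g.starDensity 1 ^ 2) := by
  set e := g.starDensity 1 with he
  have h0 : (g.blend s).starDensity 2 = ∫ x, ((s : ℝ) ^ 2 * g.degree x ^ 2
      + (2 * s * (1 - s) * e * g.degree x ^ 1 + ((1 - s) * e) ^ 2)) := by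
    unfold starDensity
    congr 1; ext x
    rw [degree_blend]; ring
  have h1 := (g.integrable_degree_pow 1 (μ := volume)).const_mul (2 * s * (1 - s) * e)
  have h2 := (g.integrable_degree_pow 2 (μ := volume)).const_mul ((s : ℝ) ^ 2)
  have h3 : Integrable fun x => 2 * s * (1 - s) * e * g.degree x ^ 1 + ((1 - s) * e) ^ 2 :=
    h1.add (integrable_const _)
  have e1 : ∫ x, g.degree x ^ 1 = e := rfl
  have e2 : ∫ x, g.degree x ^ 2 = g.starDensity 2 := rfl
  rw [h0, integral_add h2 h3, integral_add h1 (integrable_const _), integral_const_mul,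
    integral_const_mul, e1, e2]
  simp only [integral_const, probReal_univ, smul_eq_mul]
  ring

/-- Blending multiplies the variance t_2 - t_1² of the degrees by s², so s is the square root of the
required ratio. -/
lemma mem_feasible_of_le (g : Graphon) {t : ℝ} (h1 : g.starDensity 1 ^ 2 ≤ t)
    (h2 : t ≤ g.starDensity 2) : (g.starDensity 1, t) ∈ feasible := by
  rcases h1.eq_or_lt with h | h
  · refine ⟨g.blend 0, Prod.ext (g.starDensity_one_blend _) ?_⟩
    change (g.blend 0).starDensity 2 = t
    rw [starDensity_two_blend, ← h]; simp
  · have hpos : 0 < g.starDensity 2 - g.starDensity 1 ^ 2 := by linarith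
    set v := (t - g.starDensity 1 ^ 2) / (g.starDensity 2 - g.starDensity 1 ^ 2) with hv
    have hv0 : 0 ≤ v := div_nonneg (by linarith) hpos.le
    have hv1 : v ≤ 1 := (div_le_one hpos).2 (by linarith)
    refine ⟨g.blend ⟨√v, Real.sqrt_nonneg _, Real.sqrt_le_one.2 hv1⟩,
      Prod.ext (g.starDensity_one_blend _) ?_⟩
    change (g.blend _).starDensity 2 = t
    rw [starDensity_two_blend, Real.sq_sqrt hv0, hv]
    field_simp
    ring

lemma mem_feasible_of_le_clique {r t : ℝ} (hr : r ∈ Icc (0 : ℝ) 1) (h1 : (r ^ 2) ^ 2 ≤ t)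
    (h2 : t ≤ r ^ 3) : (r ^ 2, t) ∈ feasible := by
  have e1 := starDensity_clique ⟨r, hr⟩ one_ne_zero
  have e2 := starDensity_clique ⟨r, hr⟩ two_ne_zero
  have := mem_feasible_of_le (clique r) (t := t) (by rw [e1]; exact h1) (by rw [e2]; exact h2)
  rwa [e1] at this

/-- The action of complementation on pairs of densities. -/
def complDensities (τ : ℝ × ℝ) : ℝ × ℝ := (1 - τ.1, 1 - 2 * τ.1 + τ.2)

lemma complDensities_mem_feasible {τ : ℝ × ℝ} (h : τ ∈ feasible) :
    complDensities τ ∈ feasible := by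
  obtain ⟨g, rfl⟩ := h
  exact ⟨g.reverseCompl, Prod.ext g.starDensity_one_reverseCompl g.starDensity_two_reverseCompl⟩

lemma complDensities_complDensities (τ : ℝ × ℝ) : complDensities (complDensities τ) = τ := by
  refine Prod.ext ?_ ?_ <;> simp only [complDensities] <;> ring

lemma continuous_complDensities : Continuous complDensities := by
  unfold complDensities; fun_prop

lemma mem_interior_feasible_of_lt {e t : ℝ} (he : e ∈ Ioo (0 : ℝ) 1) (h1 : e ^ 2 < t)
    (h2 : t < √e ^ 3) : (e, t) ∈ interior feasible := by
  have hopen : IsOpen {τ : ℝ × ℝ | τ.1 ∈ Ioo (0 : ℝ) 1 ∧ τ.1 ^ 2 < τ.2 ∧ τ.2 < √τ.1 ^ 3} := by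
    have o1 : IsOpen {τ : ℝ × ℝ | τ.1 ^ 2 < τ.2} := isOpen_lt (by fun_prop) (by fun_prop)
    have o2 : IsOpen {τ : ℝ × ℝ | τ.2 < √τ.1 ^ 3} := isOpen_lt (by fun_prop) (by fun_prop)
    exact (isOpen_Ioo.preimage continuous_fst).inter (o1.inter o2)
  refine mem_interior.2 ⟨_, ?_, hopen, ⟨he, h1, h2⟩⟩
  rintro ⟨e, t⟩ ⟨he, h1, h2⟩
  have hs : √e ^ 2 = e := Real.sq_sqrt he.1.le
  have := mem_feasible_of_le_clique (r := √e) (t := t)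
    ⟨Real.sqrt_nonneg _, Real.sqrt_le_one.2 he.2.le⟩ (by rw [hs]; exact h1.le) h2.le
  rwa [hs] at this

lemma mem_interior_feasible_of_compl {τ : ℝ × ℝ} (h : complDensities τ ∈ interior feasible) :
    τ ∈ interior feasible := by
  refine mem_interior.2 ⟨complDensities ⁻¹' interior feasible, fun σ hσ => ?_,
    isOpen_interior.preimage continuous_complDensities, h⟩
  have := complDensities_mem_feasible (interior_subset hσ)
  rwa [complDensities_complDensities] at this

end Graphon

/-! ### Near the corner -/

namespace Graphon

lemma two_rpow_neg_three_halves : (2 : ℝ) ^ (-(3 / 2) : ℝ) = √(1 / 2) / 2 := by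
  have h : (-(3 / 2) : ℝ) = -1 + -(1 / 2) := by norm_num
  rw [h, Real.rpow_add two_pos, Real.rpow_neg_one, Real.rpow_neg two_pos.le, ← Real.sqrt_eq_rpow,
    one_div, Real.sqrt_inv]
  ring

lemma sqrt_half_sq : √(1 / 2 : ℝ) ^ 2 = 1 / 2 := Real.sq_sqrt (by norm_num)

lemma sqrt_half_mem : √(1 / 2 : ℝ) ∈ Icc (0.7071 : ℝ) 0.7072 :=
  ⟨Real.le_sqrt_of_sq_le (by norm_num), Real.sqrt_le_iff.2 ⟨by norm_num, by norm_num⟩⟩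

lemma clique_symm_symm (c : ℝ) (x y : unitInterval) :
    (clique c) (unitInterval.symm x) (unitInterval.symm y) = 1 - (anticlique (1 - c)) x y := by
  have h : ∀ z : unitInterval, ((unitInterval.symm z : unitInterval) : ℝ) < c ↔ 1 - c < z := by
    intro z
    rw [unitInterval.coe_symm_eq]
    constructor <;> intro h <;> linarith
  simp only [clique, anticlique, h]
  split_ifs <;> simp

lemma integral_abs_reverseCompl_sub_anticlique (g : Graphon) (c : ℝ) :
    ∫ p : unitInterval × unitInterval, |g.reverseCompl p.1 p.2 - (anticlique (1 - c)) p.1 p.2|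
      = ∫ p : unitInterval × unitInterval, |g p.1 p.2 - (clique c) p.1 p.2| := by
  rw [← integral_comp_symm_prod fun p => |g p.1 p.2 - (clique c) p.1 p.2|]
  congr 1; ext p
  simp only [reverseCompl_apply, clique_symm_symm]
  rw [abs_sub_comm]
  congr 1; ring

/-- Close to the corner there are inequivalent maximizers near the clique and the anticlique. -/
lemma exists_isMaximizer_pair {η t : ℝ} (hη : 0 < η)
    (ht : t ∈ Ioc (√(1 / 2 : ℝ) / 2 - (min η 0.01 / 10) ^ 2 / 100) (√(1 / 2) / 2)) :
    ∃ g h : Graphon, g.IsMaximizer (1 / 2, t) ∧ h.IsMaximizer (1 / 2, t) ∧ ¬ Equivalent g h ∧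
      cutDist g (clique √(1 / 2)) < η ∧ cutDist h (anticlique (1 - √(1 / 2))) < η := by
  set c : ℝ := √(1 / 2) with hc
  have hc2 : c ^ 2 = 1 / 2 := sqrt_half_sq
  obtain ⟨hcl, hcu⟩ : c ∈ Icc (0.7071 : ℝ) 0.7072 := sqrt_half_mem
  have hc3 : c ^ 3 = c / 2 := by rw [pow_succ, hc2]; ring
  -- The window κ²/100 for t gives c - a < κ, hence L¹ distance below 6κ < η. The cap 0.01 keeps the
  -- 3-star densities apart.
  set κ := min η 0.01 / 10 with hκ
  have hκ0 : 0 < κ := div_pos (lt_min hη (by norm_num)) (by norm_num)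
  have hκ1 : 10 * κ ≤ η := by linarith [min_le_left η (0.01 : ℝ)]
  have hκ2 : κ ≤ 0.001 := by linarith [min_le_right η (0.01 : ℝ)]
  have hκ3 : κ ^ 2 ≤ 0.001 := by nlinarith
  obtain ⟨ht1, ht2⟩ := ht
  have hfeas : ((1 / 2 : ℝ), t) ∈ feasible := by
    rw [← hc2]
    refine mem_feasible_of_le_clique ⟨by linarith, by linarith⟩ ?_ (by rw [hc3]; exact ht2)
    rw [hc2]; linarith
  -- Complementation fixes (1/2, t), so the maximizer or its complement is a maximizer with a large
  -- core.
  obtain ⟨G, a, hG, ha, hcore⟩ : ∃ (G : Graphon) (a : unitInterval), G.IsMaximizer (1 / 2, t) ∧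
      1 / 2 ≤ (a : ℝ) ∧ G.IsCore (Iio a) := by
    obtain ⟨g, q, hq, hg⟩ := exists_isMaximizer_hasAntitoneDegree hfeas
    rcases hq.exists_large_core with ⟨a, ha, h⟩ | ⟨a, ha, h⟩
    · exact ⟨g, a, hg, ha, h⟩
    · exact ⟨g.reverseCompl, a, hg.reverseCompl, ha, h⟩
  have h1 : G.starDensity 1 = 1 / 2 := congrArg Prod.fst hG.1
  have h2 : G.starDensity 2 = t := congrArg Prod.snd hG.1
  have hgap := hcore.two_star_le_clique (by rw [volume_real_Iio]; exact ha) (r := c)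
    ⟨by linarith, by linarith⟩ (by rw [h1, hc2])
  have h3 := hcore.three_star_le
  have hac := hcore.sq_le
  rw [volume_real_Iio] at hgap h3 hac
  rw [h2, hc3] at hgap
  rw [h1] at h3 hac
  have hac' : (a : ℝ) ≤ c := le_of_sq_le_sq (hac.trans_eq hc2.symm) (by linarith)
  have hca : c - a < κ := by
    refine lt_of_pow_lt_pow_left₀ 2 hκ0.le ?_
    linarith
  have hdist := hcore.integral_abs_sub_clique_le (c := ⟨c, by constructor <;> linarith⟩)
    (by rw [h1, ← hc2])
  have hdist' : 4 * (c ^ 2 - (a : ℝ) ^ 2) < 6 * κ := by nlinarith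
  refine ⟨G, G.reverseCompl, hG, hG.reverseCompl, fun hequiv => ?_, ?_, ?_⟩
  -- Equal 3-star densities would equal (3t - 1/2)/2, about 0.28, whereas `three_star_le` bounds
  -- that of G by about 0.254.
  · have h4 := hequiv.starDensity_eq 3
    rw [starDensity_three_reverseCompl, h1, h2] at h4
    have h5 : (a : ℝ) ^ 4 ≤ 1 / 4 := by nlinarith
    linarith
  · refine (cutDist_le_integral_abs _ _).trans_lt (hdist.trans_lt ?_)
    linarith
  · refine (cutDist_le_integral_abs _ _).trans_lt ?_
    rw [integral_abs_reverseCompl_sub_anticlique]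
    refine hdist.trans_lt ?_
    linarith

/-- Graphons with a large core close to the corner have the 3-star density of the clique. -/
lemma IsCore.three_star_le_near_corner {g : Graphon} {P : Set unitInterval} (h : g.IsCore P)
    (ha : 1 / 2 ≤ volume.real P) {s ε : ℝ} (hs : |s| ≤ 1 / 10 ^ 8) (hε : ε ≤ 1 / 10 ^ 8)
    (h1 : g.starDensity 1 = 1 / 2 + s) (h2 : g.starDensity 2 = √(1 / 2) / 2 - ε + s) :
    g.starDensity 3 ≤ 0.27 ∧ √(1 / 2) / 2 - ε + s ≤ √(1 / 2 + s) ^ 3 := by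
  obtain ⟨hs1, hs2⟩ := abs_le.1 hs
  set c : ℝ := √(1 / 2) with hc
  have hc2 : c ^ 2 = 1 / 2 := sqrt_half_sq
  obtain ⟨hcl, hcu⟩ : c ∈ Icc (0.7071 : ℝ) 0.7072 := sqrt_half_mem
  set r := √(1 / 2 + s) with hr
  have hr2 : r ^ 2 = 1 / 2 + s := Real.sq_sqrt (by linarith)
  have hrl : 0.7 ≤ r := Real.le_sqrt_of_sq_le (by linarith)
  have hru : r ≤ 0.715 := Real.sqrt_le_iff.2 ⟨by norm_num, by linarith⟩
  have hgap := h.two_star_le_clique ha ⟨hrl, hru⟩ (by rw [h1, hr2])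
  have h3 := h.three_star_le
  have hsq := h.sq_le
  set a := volume.real P
  rw [h2] at hgap
  rw [h1, ← hr2] at h3 hsq
  have har : a ≤ r := le_of_sq_le_sq hsq (by linarith)
  refine ⟨?_, hgap.trans (by linarith [sq_nonneg (r - a)])⟩
  have hrc : r - c ≤ 1 / 10 ^ 8 := by nlinarith
  have hr3 : r ^ 3 = r / 2 + r * s := by rw [pow_succ, hr2]; ring
  have hrs : (r - 1) * s ≤ 1 / 10 ^ 8 := by nlinarith
  -- The deficit r³ - t_2 = (r - c)/2 + (r - 1)s + ε is at most 2.5/10^8, and it is at least (r -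
  -- a)²/100.
  have hra : (r - a) ^ 2 ≤ 0.002 ^ 2 := by linarith
  have hra' : r - a ≤ 0.002 := le_of_sq_le_sq hra (by norm_num)
  have ha4 : a ^ 4 ≤ (1 / 2 + s) ^ 2 := by
    rw [← hr2]
    have := mul_self_le_mul_self (sq_nonneg a) hsq
    linarith
  nlinarith

/-- The dichotomy between clique-like and anticlique-like graphons close to the corner. -/
lemma three_star_dichotomy (g : Graphon) {s ε : ℝ} (hs : |s| ≤ 1 / 10 ^ 8) (hε : ε ≤ 1 / 10 ^ 8)
    (h1 : g.starDensity 1 = 1 / 2 + s) (h2 : g.starDensity 2 = √(1 / 2) / 2 - ε + s) :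
    (g.starDensity 3 ≤ 0.27 ∧ √(1 / 2) / 2 - ε + s ≤ √(1 / 2 + s) ^ 3) ∨
      (0.29 ≤ g.starDensity 3 ∧ √(1 / 2) / 2 - ε - s ≤ √(1 / 2 - s) ^ 3) := by
  obtain ⟨g', q, hq1, hq2, hq3, hk, -⟩ := g.exists_antitone_rearrangement
  rcases (HasAntitoneDegree.mk hq1 hq2 hq3).exists_large_core with ⟨a, ha, h⟩ | ⟨a, ha, h⟩
  · left
    rw [← hk 3]
    exact h.three_star_le_near_corner (by rw [volume_real_Iio]; exact ha) hs hε
      (by rw [hk, h1]) (by rw [hk, h2])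
  · right
    obtain ⟨h3, h4⟩ := h.three_star_le_near_corner (s := -s) (ε := ε)
      (by rw [volume_real_Iio]; exact ha) (by rwa [abs_neg]) hε
      (by rw [starDensity_one_reverseCompl, hk, h1]; ring)
      (by rw [starDensity_two_reverseCompl, hk, hk, h1, h2]; ring)
    refine ⟨?_, by simpa only [sub_eq_add_neg] using h4⟩
    -- In 1 - 3t_1 + 3t_2 the terms in s cancel, leaving 3c/2 - 1/2 - 3ε > 0.56, so a complement at
    -- most 0.27 means at least 0.29.
    rw [starDensity_three_reverseCompl, hk, hk, hk, h1, h2] at h3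
    have := sqrt_half_mem.1
    linarith

/-- The clique curve t_2 = t_1^(3/2) has slope 3c/2 > 1 at the corner, so for s ≥ 0 the segment of
slope 1 lowered by ε stays below it. Complementation exchanges s and -s on this segment. -/
lemma mem_interior_feasible_near_corner {s ε : ℝ} (hs : |s| ≤ 1 / 10 ^ 8) (hε : 0 < ε)
    (hε' : ε ≤ 1 / 10 ^ 8) : (1 / 2 + s, √(1 / 2) / 2 - ε + s) ∈ interior feasible := by
  have key : ∀ s : ℝ, 0 ≤ s → s ≤ 1 / 10 ^ 8 →
      (1 / 2 + s, √(1 / 2) / 2 - ε + s) ∈ interior feasible := by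
    intro s hs0 hs1
    set c : ℝ := √(1 / 2) with hc
    have hc2 : c ^ 2 = 1 / 2 := sqrt_half_sq
    obtain ⟨hcl, hcu⟩ : c ∈ Icc (0.7071 : ℝ) 0.7072 := sqrt_half_mem
    refine mem_interior_feasible_of_lt ⟨by linarith, by linarith⟩ (by nlinarith) ?_
    have hr2 : √(1 / 2 + s) ^ 2 = 1 / 2 + s := Real.sq_sqrt (by linarith)
    have hcr : c ≤ √(1 / 2 + s) := Real.sqrt_le_sqrt (by linarith)
    have hru : √(1 / 2 + s) ≤ 0.715 := Real.sqrt_le_iff.2 ⟨by norm_num, by linarith⟩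
    set r := √(1 / 2 + s)
    have hr3 : r ^ 3 = r / 2 + r * s := by rw [pow_succ, hr2]; ring
    have hs' : s = (r - c) * (r + c) := by linear_combination hc2 - hr2
    have : s * (1 - r) ≤ (r - c) / 2 := by
      rw [hs']
      have h5 : (r + c) * (1 - r) ≤ 1 / 2 := by nlinarith
      nlinarith [mul_le_mul_of_nonneg_left h5 (sub_nonneg.2 hcr)]
    linarith
  obtain ⟨hs1, hs2⟩ := abs_le.1 hs
  rcases le_total 0 s with h | h
  · exact key s h hs2
  · refine mem_interior_feasible_of_compl ?_
    have := key (-s) (by linarith) (by linarith)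
    convert this using 2 <;> simp only [complDensities] <;> ring

/-- The slope 3c/2 ≈ 1.06 also exceeds 1 + 1/20, so to the left of the corner the clique curve falls
below the segment lowered by δ/20. -/
lemma clique_lt_corner {δ : ℝ} (h0 : 0 < δ) (h1 : δ ≤ 1 / 10 ^ 8) :
    √(1 / 2 - δ) ^ 3 < √(1 / 2) / 2 - δ / 20 - δ := by
  set c : ℝ := √(1 / 2) with hc
  have hc2 : c ^ 2 = 1 / 2 := sqrt_half_sq
  obtain ⟨hcl, hcu⟩ : c ∈ Icc (0.7071 : ℝ) 0.7072 := sqrt_half_mem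
  have hr2 : √(1 / 2 - δ) ^ 2 = 1 / 2 - δ := Real.sq_sqrt (by linarith)
  have hcr : √(1 / 2 - δ) ≤ c := Real.sqrt_le_sqrt (by linarith)
  have hrl : 0.705 ≤ √(1 / 2 - δ) := Real.le_sqrt_of_sq_le (by linarith)
  set r := √(1 / 2 - δ)
  have hr3 : r ^ 3 = r / 2 - r * δ := by rw [pow_succ, hr2]; ring
  have hδ : δ = (c - r) * (c + r) := by linear_combination hr2 - hc2
  have h5 : δ * 0.7 ≤ c - r := by
    rw [hδ]
    nlinarith [mul_nonneg (sub_nonneg.2 hcr) (by linarith : 0 ≤ 1 - (c + r) * 0.7)]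
  nlinarith

/-- There is no continuous choice of maximizers near the corner. -/
lemma not_cutContinuousOn {U : Set (ℝ × ℝ)} (hU : U ∈ 𝓝 ((1 / 2 : ℝ), √(1 / 2 : ℝ) / 2))
    {G : ℝ × ℝ → Graphon} (hG : ∀ τ ∈ U ∩ interior feasible, (G τ).IsMaximizer τ) :
    ¬ CutContinuousOn G (U ∩ interior feasible) := by
  intro hcont
  obtain ⟨ρ, hρ, hball⟩ := Metric.mem_nhds_iff.1 hU
  set δ := min (ρ / 4) (1 / 10 ^ 8) with hδ
  have hδ0 : 0 < δ := lt_min (by linarith) (by norm_num)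
  have hδ1 : δ ≤ 1 / 10 ^ 8 := min_le_right _ _
  have hδρ : δ ≤ ρ / 4 := min_le_left _ _
  -- Slope 1 makes the path invariant under complementation, and the drop δ/20 keeps it feasible
  -- while both ends stay within reach of `clique_lt_corner`.
  set γ : ℝ → ℝ × ℝ := fun s => (1 / 2 + s, √(1 / 2) / 2 - δ / 20 + s) with hγ
  have hγc : Continuous γ := by fun_prop
  have hmaps : MapsTo γ (Icc (-δ) δ) (U ∩ interior feasible) := by
    intro s hs
    refine ⟨hball ?_, mem_interior_feasible_near_corner ((abs_le.2 hs).trans hδ1)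
      (by linarith) (by linarith)⟩
    rw [Metric.mem_ball, Prod.dist_eq, max_lt_iff, Real.dist_eq, Real.dist_eq, abs_lt, abs_lt]
    simp only [hγ]
    refine ⟨⟨?_, ?_⟩, ?_, ?_⟩ <;> linarith [hs.1, hs.2]
  have hf : ContinuousOn (fun s => (G (γ s)).starDensity 3) (Icc (-δ) δ) :=
    hcont.continuousOn_starDensity_three.comp hγc.continuousOn hmaps
  have hdich : ∀ s ∈ Icc (-δ) δ, _ := fun s hs =>
    (G (γ s)).three_star_dichotomy (s := s) (ε := δ / 20) ((abs_le.2 hs).trans hδ1) (by linarith)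
      (congrArg Prod.fst (hG _ (hmaps hs)).1) (congrArg Prod.snd (hG _ (hmaps hs)).1)
  have hlt := clique_lt_corner hδ0 hδ1
  have hle : -δ ≤ δ := by linarith
  have hleft : 0.29 ≤ (G (γ (-δ))).starDensity 3 := by
    rcases hdich (-δ) (left_mem_Icc.2 hle) with ⟨-, h⟩ | ⟨h, -⟩
    · rw [← sub_eq_add_neg, ← sub_eq_add_neg] at h
      exact absurd h (not_le.2 hlt)
    · exact h
  have hright : (G (γ δ)).starDensity 3 ≤ 0.27 := by
    rcases hdich δ (right_mem_Icc.2 hle) with ⟨h, -⟩ | ⟨-, h⟩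
    · exact h
    · exact absurd h (not_le.2 hlt)
  -- The value 0.28 lies in the gap between 0.27 and 0.29 that the dichotomy forbids.
  obtain ⟨s, hs, hs'⟩ := intermediate_value_Icc' hle hf
    (show (0.28 : ℝ) ∈ Icc _ _ from ⟨by linarith, by linarith⟩)
  simp only at hs'
  rcases hdich s hs with ⟨h, -⟩ | ⟨h, -⟩ <;> linarith

end Graphon

theorem mainTheorem6 :
    -- inequivalent maximizers on the segment, arbitrarily close to the clique and the anticlique
    (∀ η : ℝ, 0 < η → ∃ τs : ℝ, τs < (2 : ℝ) ^ (-(3 / 2) : ℝ) ∧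
      ∀ τ₂ ∈ Set.Ioc τs ((2 : ℝ) ^ (-(3 / 2) : ℝ)),
        ∃ g h : Graphon,
          g.IsMaximizer (1 / 2, τ₂) ∧ h.IsMaximizer (1 / 2, τ₂) ∧ ¬ Graphon.Equivalent g h ∧
          Graphon.cutDist g (Graphon.clique (Real.sqrt (1 / 2))) < η ∧
          Graphon.cutDist h (Graphon.anticlique (1 - Real.sqrt (1 / 2))) < η) ∧
    -- no continuous choice of maximizers near the corner, not even over interior constraints
    (∀ U ∈ 𝓝 ((1 / 2 : ℝ), (2 : ℝ) ^ (-(3 / 2) : ℝ)), ∀ G : ℝ × ℝ → Graphon,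
      (∀ τ ∈ U ∩ interior Graphon.feasible, (G τ).IsMaximizer τ) →
      ¬ Graphon.CutContinuousOn G (U ∩ interior Graphon.feasible)) := by
  rw [Graphon.two_rpow_neg_three_halves]
  refine ⟨fun η hη => ⟨√(1 / 2) / 2 - (min η 0.01 / 10) ^ 2 / 100, ?_, fun t ht =>
    Graphon.exists_isMaximizer_pair hη ht⟩, fun U hU G hG => Graphon.not_cutContinuousOn hU hG⟩
  have : 0 < min η 0.01 := lt_min hη (by norm_num)
  exact sub_lt_self _ (by positivity)
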